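/- Let $S^1=\mathbb R/\mathbb Z$, let $\theta\in[0,1)$ be irrational, and let $\mathcal G=\mathbb Z\ltimes S^1$ be the irrational rotation groupoid: its arrows are the $(n,x)\in\mathbb Z\times S^1$, with source $s(n,x)=x$, range $r(n,x)=x+n\theta$ and product $(m,x+n\theta)(n,x)=(m+n,x)$. Let $\mathcal G^{(0)}=S^1$, $\mathcal G^{(1)}=\mathcal G$, and let $\mathcal G^{(2)}$ be the space of composable pairs. Let $\mathcal Z$ be the sheaf of locally constant $\mathbb Z$-valued functions on $S^1$. Let $\mathcal S^0$ be the sheaf of $\mathbb Z$-valued functions that have a discrete set of discontinuities, have a left limit at every point, and are right-continuous at every point. Let $\mathcal S^1$ be the sheaf of $\mathbb Z$-valued functions with discrete support (no accumulation points in the open set considered), and let $\partial:\mathcal S^0\to\mathcal S^1$ be $(\partial s)(x)=s(x)-\lim_{y\to x^-}s(y)$. For a sheaf $\mathcal S$ on $S^1$ let $\mathcal S_n$ be its pullback along the map $\mathcal G^{(n)}\to\mathcal G^{(0)}$, $(x_0\leftarrow\cdots\leftarrow x_n)\mapsto x_0$, and let $\Gamma_c$ denote compactly supported sections. Let $\delta=\sum_{i=0}^n(-1)^i\delta_i:\Gamma_c(\mathcal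 G^{(n)};\mathcal S_n)\to\Gamma_c(\mathcal G^{(n-1)};\mathcal S_{n-1})$, where $\delta_i$ is summation over the fibres of the $i$-th face map (omit $x_0$ for $i=0$, omit $x_n$ for $i=n$, compose at $x_i$ otherwise); thus for $n=1$, $(\delta t)(x)=\sum_{s(g)=x}t(g)-\sum_{r(g)=x}t(g)$. Then $0\to\mathcal Z\to\mathcal S^0\xrightarrow{\partial}\mathcal S^1\to0$ is a resolution of $\mathcal Z$ by $c$-soft $\mathcal G$-sheaves. Let $H_*(\mathcal G)$ be the homology of the total complex of the double complex $\Gamma_c(\mathcal G^{(p)};\mathcal S^q_p)$ (total degree $p-q$), with horizontal differential $\delta$ and vertical differential $(-1)^p\partial$. So a class in $H_0(\mathcal G)$ is represented by a pair $(a,b)\in\Gamma_c(\mathcal G^{(0)};\mathcal S^0_0)\oplus\Gamma_c(\mathcal G^{(1)};\mathcal S^1_1)$ with $\partial a=-\delta b$, and the boundaries are the pairs $(\delta e,\,-\partial e+\delta c)$ with $e\in\Gamma_c(\mathcal G^{(1)};\mathcal S^0_1)$ and $c\in\Gamma_c(\mathcal G^{(2)};\mathcal S^1_2)$. Let $H^0(S^1)$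 and $H^1(S^1)$ be the kernel and cokernel of $\partial:\Gamma_c(S^1;\mathcal S^0)\to\Gamma_c(S^1;\mathcal S^1)$. **Proposition.** 1. Lebesgue measure $\tau$ on $S^1$ is the unique invariant Borel probability measure for $\mathcal G$. 2. The map $\phi_0:H^0(S^1)\to H_0(\mathcal G)$, $a\mapsto[(a,0)]$, is a well-defined homomorphism. 3. For $b\in\Gamma_c(S^1;\mathcal S^1)$ write $\alpha(b)(x)=b(x-\theta)$, and let $b_1(m,x)=b(x)$ if $m=1$ and $b_1(m,x)=0$ otherwise. There is a unique $a_b\in\Gamma_c(S^1;\mathcal S^0)$ with $\partial a_b=b-\alpha(b)$ and $a_b(0)=\sum_{x\in(-\theta,0]}b(x)$, where $(-\theta,0]$ denotes the corresponding arc in $S^1$ (so $a_b(0)=b(0)$ if $b$ is supported at $0$). Moreover $\phi_1:H^1(S^1)\to H_0(\mathcal G)$, $[b]\mapsto[(a_b,-b_1)]$, is a well-defined homomorphism. 4. The pairing $H_0(\mathcal G)\to\mathbb C$, $[(a,b)]\mapsto\tau([(a,b)]):=\int_{S^1}a\,d\tau$, is well defined (all such $a$ are integrable). 5. The map $\phi_0\oplus\phi_1:H^0(S^1)\oplus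 H^1(S^1)\to H_0(\mathcal G)$ is an isomorphism, and $H_0(\mathcal G)\cong\mathbb Z\oplus\mathbb Z$. 6. $H^0(S^1)$ is infinite cyclic, generated by the constant function $a=1$; $H^1(S^1)$ is infinite cyclic, generated by the class of the function $b$ with value $1$ at $0$ and $0$ elsewhere; and $\tau(\phi_0(a))=1$, $\tau(\phi_1(b))=\theta$. -/

import Mathlib

open MeasureTheory Filter Topology Set

noncomputable section

namespace RotationGroupoid

/-! ### Sheaves of integer-valued functions -/

/-- A subsheaf of the sheaf of all `ℤ`-valued functions on `X`.  The sections over an open set `U`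
are the restrictions to `U` of the functions in `sec U`; by `congr`, membership in `sec U` depends
only on the values on `U`. -/
structure IntSheaf (X : Type*) [TopologicalSpace X] where
  /-- Sections over `U` (only used for open `U`). -/
  sec : Set X → AddSubgroup (X → ℤ)
  res : ∀ {U V : Set X}, V ⊆ U → sec U ≤ sec V
  congr : ∀ {U : Set X} {s t : X → ℤ}, IsOpen U → EqOn s t U → s ∈ sec U → t ∈ sec U
  glue : ∀ {U : Set X} {s : X → ℤ},
    (∀ x ∈ U, ∃ V : Set X, IsOpen V ∧ x ∈ V ∧ s ∈ sec V) → s ∈ sec U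

namespace IntSheaf

variable {X Y : Type*} [TopologicalSpace X] [TopologicalSpace Y]

/-- A sheaf is `c`-soft if every section near a compact set extends, near that set, to a global
section. -/
def IsCSoft (F : IntSheaf X) : Prop :=
  ∀ (K U : Set X), IsCompact K → IsOpen U → K ⊆ U → ∀ s ∈ F.sec U,
    ∃ V : Set X, IsOpen V ∧ K ⊆ V ∧ V ⊆ U ∧ ∃ t ∈ F.sec univ, EqOn s t V

/-- The pullback (inverse image) sheaf along a local homeomorphism `f`: its sections are the
functions that are locally of the form `s ∘ f` with `s` a section of `F`. -/
def pullback (F : IntSheaf X) (f : Y → X) : IntSheaf Y where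
  sec V :=
    { carrier := {t | ∀ g ∈ V, ∃ U : Set X, IsOpen U ∧ f g ∈ U ∧
        ∃ s ∈ F.sec U, ∀ᶠ g' in 𝓝 g, t g' = s (f g')}
      zero_mem' := fun g _ => ⟨univ, isOpen_univ, mem_univ _, 0, (F.sec _).zero_mem,
        Eventually.of_forall fun _ => rfl⟩
      add_mem' := by
        intro a b ha hb g hg
        obtain ⟨U, hU, hgU, s, hs, h⟩ := ha g hg
        obtain ⟨U', hU', hgU', s', hs', h'⟩ := hb g hg
        refine ⟨U ∩ U', hU.inter hU', ⟨hgU, hgU'⟩, s + s',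
          (F.sec _).add_mem (F.res inter_subset_left hs) (F.res inter_subset_right hs'), ?_⟩
        filter_upwards [h, h'] with g' e e'
        simp [e, e']
      neg_mem' := by
        intro a ha g hg
        obtain ⟨U, hU, hgU, s, hs, h⟩ := ha g hg
        refine ⟨U, hU, hgU, -s, (F.sec _).neg_mem hs, ?_⟩
        filter_upwards [h] with g' e
        simp [e] }
  res h := fun _ ht g hg => ht g (h hg)
  congr := by
    intro V s t hV hst hs g hg
    obtain ⟨U, hU, hgU, u, hu, h⟩ := hs g hg
    refine ⟨U, hU, hgU, u, hu, ?_⟩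
    filter_upwards [h, hV.mem_nhds hg] with g' e hg'
    rw [← hst hg', e]
  glue h := fun g hg => by
    obtain ⟨V, _, hgV, hs⟩ := h g hg
    exact hs g hgV

theorem mem_pullback_id {F : IntSheaf X} {t : X → ℤ} :
    t ∈ (F.pullback id).sec univ ↔ t ∈ F.sec univ := by
  constructor
  · intro h
    refine F.glue fun x _ => ?_
    obtain ⟨U, hU, hxU, s, hs, hts⟩ := h x (mem_univ x)
    obtain ⟨W, hW, hWo, hxW⟩ := eventually_nhds_iff.1 hts
    exact ⟨U ∩ W, hU.inter hWo, ⟨hxU, hxW⟩,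
      F.congr (hU.inter hWo) (fun y hy => (hW y hy.2).symm) (F.res inter_subset_left hs)⟩
  · intro h x _
    exact ⟨univ, isOpen_univ, mem_univ _, t, h, Eventually.of_forall fun _ => rfl⟩

/-- The group `Γ_c(X; F)` of compactly supported global sections. -/
def compactSections (F : IntSheaf X) : AddSubgroup (X → ℤ) where
  carrier := {s | s ∈ F.sec univ ∧ HasCompactSupport s}
  zero_mem' := ⟨(F.sec _).zero_mem, HasCompactSupport.zero⟩
  add_mem' ha hb := ⟨(F.sec _).add_mem ha.1 hb.1, ha.2.add hb.2⟩
  neg_mem' ha := ⟨(F.sec _).neg_mem ha.1, ha.2.neg⟩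

end IntSheaf

/-! ### The sheaves `𝒵`, `𝒮⁰`, `𝒮¹` on the circle -/

/-- The circle `ℝ / ℤ`. -/
abbrev Circ : Type := UnitAddCircle

/-- The filter `y → x⁻` on the circle. -/
def leftNhds (x : Circ) : Filter Circ := map (fun t : ℝ => x + (t : Circ)) (𝓝[<] (0 : ℝ))

/-- The filter `y → x⁺` on the circle. -/
def rightNhds (x : Circ) : Filter Circ := map (fun t : ℝ => x + (t : Circ)) (𝓝[>] (0 : ℝ))

instance leftNhds_neBot (x : Circ) : (leftNhds x).NeBot := by
  unfold leftNhds; infer_instance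

theorem tendsto_circ (x : Circ) : Tendsto (fun t : ℝ => x + (t : Circ)) (𝓝 0) (𝓝 x) := by
  have h : Continuous (fun t : ℝ => x + (t : Circ)) :=
    continuous_const.add (AddCircle.continuous_mk' 1)
  simpa using h.tendsto 0

theorem leftNhds_le (x : Circ) : leftNhds x ≤ 𝓝 x :=
  (map_mono nhdsWithin_le_nhds).trans (tendsto_circ x)

theorem rightNhds_le (x : Circ) : rightNhds x ≤ 𝓝 x :=
  (map_mono nhdsWithin_le_nhds).trans (tendsto_circ x)

/-- The sheaf `𝒵` of locally constant functions. -/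
def sheafZ : IntSheaf Circ where
  sec U :=
    { carrier := {s | ∀ x ∈ U, ∀ᶠ y in 𝓝 x, s y = s x}
      zero_mem' := fun _ _ => Eventually.of_forall fun _ => rfl
      add_mem' := by
        intro a b ha hb x hx
        filter_upwards [ha x hx, hb x hx] with y e e'
        simp [e, e']
      neg_mem' := by
        intro a ha x hx
        filter_upwards [ha x hx] with y e
        simp [e] }
  res h := fun _ hs x hx => hs x (h hx)
  congr := by
    intro U s t hU hst hs x hx
    filter_upwards [hs x hx, hU.mem_nhds hx] with y e hy
    rw [← hst hy, ← hst hx, e]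
  glue h := fun x hx => by
    obtain ⟨V, _, hxV, hs⟩ := h x hx
    exact hs x hxV

/-- The sheaf `𝒮⁰`: functions with a discrete set of discontinuities in `U`, having left limits,
and continuous from the right, at every point of `U`. -/
def sheafS0 : IntSheaf Circ where
  sec U :=
    { carrier := {s | (∀ x ∈ U, ∀ᶠ y in 𝓝[≠] x, ContinuousAt s y) ∧
        ∀ x ∈ U, (∃ l : ℤ, Tendsto s (leftNhds x) (𝓝 l)) ∧
          Tendsto s (rightNhds x) (𝓝 (s x))}
      zero_mem' := ⟨fun _ _ => Eventually.of_forall fun _ => continuousAt_const,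
        fun _ _ => ⟨⟨0, tendsto_const_nhds⟩, tendsto_const_nhds⟩⟩
      add_mem' := by
        intro a b ha hb
        refine ⟨fun x hx => ?_, fun x hx => ⟨?_, ?_⟩⟩
        · filter_upwards [ha.1 x hx, hb.1 x hx] with y e e'
          exact e.add e'
        · obtain ⟨l, hl⟩ := (ha.2 x hx).1
          obtain ⟨l', hl'⟩ := (hb.2 x hx).1
          exact ⟨l + l', hl.add hl'⟩
        · exact (ha.2 x hx).2.add (hb.2 x hx).2
      neg_mem' := by
        intro a ha
        refine ⟨fun x hx => ?_, fun x hx => ⟨?_, ?_⟩⟩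
        · filter_upwards [ha.1 x hx] with y e
          exact e.neg
        · obtain ⟨l, hl⟩ := (ha.2 x hx).1
          exact ⟨-l, hl.neg⟩
        · exact (ha.2 x hx).2.neg }
  res h := fun _ hs => ⟨fun x hx => hs.1 x (h hx), fun x hx => hs.2 x (h hx)⟩
  congr := by
    intro U s t hU hst hs
    have key : ∀ x ∈ U, s =ᶠ[𝓝 x] t := fun x hx => by
      filter_upwards [hU.mem_nhds hx] with y hy using hst hy
    refine ⟨fun x hx => ?_, fun x hx => ⟨?_, ?_⟩⟩
    · filter_upwards [hs.1 x hx, mem_nhdsWithin_of_mem_nhds (hU.mem_nhds hx)] with y e hy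
      exact e.congr (key y hy)
    · obtain ⟨l, hl⟩ := (hs.2 x hx).1
      exact ⟨l, hl.congr' ((key x hx).filter_mono (leftNhds_le x))⟩
    · rw [← hst hx]
      exact (hs.2 x hx).2.congr' ((key x hx).filter_mono (rightNhds_le x))
  glue h := by
    refine ⟨fun x hx => ?_, fun x hx => ?_⟩
    · obtain ⟨V, _, hxV, hs⟩ := h x hx
      exact hs.1 x hxV
    · obtain ⟨V, _, hxV, hs⟩ := h x hx
      exact hs.2 x hxV

/-- The sheaf `𝒮¹`, in its concrete form: functions whose support has no accumulation point
in `U`. -/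
def sheafS1 : IntSheaf Circ where
  sec U :=
    { carrier := {s | ∀ x ∈ U, ∀ᶠ y in 𝓝[≠] x, s y = 0}
      zero_mem' := fun _ _ => Eventually.of_forall fun _ => rfl
      add_mem' := by
        intro a b ha hb x hx
        filter_upwards [ha x hx, hb x hx] with y e e'
        simp [e, e']
      neg_mem' := by
        intro a ha x hx
        filter_upwards [ha x hx] with y e
        simp [e] }
  res h := fun _ hs x hx => hs x (h hx)
  congr := by
    intro U s t hU hst hs x hx
    filter_upwards [hs x hx, mem_nhdsWithin_of_mem_nhds (hU.mem_nhds hx)] with y e hy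
    rw [← hst hy, e]
  glue h := fun x hx => by
    obtain ⟨V, _, hxV, hs⟩ := h x hx
    exact hs x hxV

/-- Equivariance of a sheaf of functions under rotations of the circle. -/
def RotationInvariant (F : IntSheaf Circ) : Prop :=
  ∀ (c : Circ) (U : Set Circ) (s : Circ → ℤ), s ∈ F.sec U →
    (fun x => s (x + c)) ∈ F.sec ((fun x => x + c) ⁻¹' U)

theorem tendsto_punctured (c x : Circ) :
    Tendsto (fun y : Circ => y + c) (𝓝[≠] x) (𝓝[≠] (x + c)) := by
  refine tendsto_nhdsWithin_iff.2 ⟨?_, ?_⟩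
  · exact ((continuous_id.add continuous_const).tendsto x).mono_left nhdsWithin_le_nhds
  · filter_upwards [self_mem_nhdsWithin] with y hy
    simpa using hy

theorem tendsto_left (c x : Circ) :
    Tendsto (fun y : Circ => y + c) (leftNhds x) (leftNhds (x + c)) := by
  unfold leftNhds
  rw [tendsto_map'_iff]
  refine (tendsto_map (f := fun t : ℝ => (x + c) + (t : Circ))).congr fun t => ?_
  simp only [Function.comp]
  abel

theorem tendsto_right (c x : Circ) :
    Tendsto (fun y : Circ => y + c) (rightNhds x) (rightNhds (x + c)) := by
  unfold rightNhds
  rw [tendsto_map'_iff]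
  refine (tendsto_map (f := fun t : ℝ => (x + c) + (t : Circ))).congr fun t => ?_
  simp only [Function.comp]
  abel

theorem sheafS0_rotationInvariant : RotationInvariant sheafS0 := by
  intro c U s hs
  refine ⟨fun x hx => ?_, fun x hx => ⟨?_, ?_⟩⟩
  · filter_upwards [(tendsto_punctured c x).eventually (hs.1 (x + c) hx)] with y hy
    exact ContinuousAt.comp (f := fun y : Circ => y + c) hy
      (continuous_id.add continuous_const).continuousAt
  · obtain ⟨l, hl⟩ := (hs.2 (x + c) hx).1
    exact ⟨l, hl.comp (tendsto_left c x)⟩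
  · exact (hs.2 (x + c) hx).2.comp (tendsto_right c x)

theorem sheafS1_rotationInvariant : RotationInvariant sheafS1 := by
  intro c U s hs x hx
  exact (tendsto_punctured c x).eventually (hs (x + c) hx)

/-! ### The vertical differential -/

/-- For a local homeomorphism `τ` to the circle, the filter of points approaching `g` from the
left, the orientation being the one pulled back along `τ`. -/
def leftFilter {Y : Type*} [TopologicalSpace Y] (τ : Y → Circ) (g : Y) : Filter Y :=
  comap τ (leftNhds (τ g)) ⊓ 𝓝 g

/-- The jump `(∂t)(g) = t(g) - lim_{y → g⁻} t(y)`. -/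
def jump {Y : Type*} [TopologicalSpace Y] (τ : Y → Circ) (t : Y → ℤ) (g : Y) : ℤ :=
  t g - limUnder (leftFilter τ g) t

section Jump

variable {Y : Type*} [TopologicalSpace Y] {τ : Y → Circ}

theorem map_leftFilter (hτ : ∀ g, map τ (𝓝 g) = 𝓝 (τ g)) (g : Y) :
    map τ (leftFilter τ g) = leftNhds (τ g) := by
  unfold leftFilter
  rw [Filter.push_pull', hτ]
  exact inf_eq_left.2 (leftNhds_le _)

theorem jump_eq (hτ : ∀ g, map τ (𝓝 g) = 𝓝 (τ g)) {t : Y → ℤ} {g : Y} {s : Circ → ℤ} {l : ℤ}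
    (h : ∀ᶠ g' in 𝓝 g, t g' = s (τ g')) (hl : Tendsto s (leftNhds (τ g)) (𝓝 l)) :
    Tendsto t (leftFilter τ g) (𝓝 l) ∧ jump τ t g = s (τ g) - l := by
  have hne : (leftFilter τ g).NeBot := by
    have : (map τ (leftFilter τ g)).NeBot := by
      rw [map_leftFilter hτ]; infer_instance
    exact this.of_map
  have h1 : Tendsto (fun g' => s (τ g')) (leftFilter τ g) (𝓝 l) :=
    hl.comp (map_leftFilter hτ g).le
  have h2 : Tendsto t (leftFilter τ g) (𝓝 l) :=
    h1.congr' ((h.filter_mono inf_le_right).mono fun _ e => e.symm)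
  refine ⟨h2, ?_⟩
  rw [jump, h2.limUnder_eq, h.self_of_nhds]

theorem jump_mem (hτ : ∀ g, map τ (𝓝 g) = 𝓝 (τ g)) {t : Y → ℤ}
    (ht : t ∈ (sheafS0.pullback τ).compactSections) :
    jump τ t ∈ (sheafS1.pullback τ).compactSections := by
  refine ⟨fun g hg => ?_, ?_⟩
  · obtain ⟨U, hU, hgU, s, hs, h⟩ := ht.1 g hg
    have hev : ∀ᶠ g' in 𝓝 g, τ g' ∈ U := by
      have : ∀ᶠ y in map τ (𝓝 g), y ∈ U := by rw [hτ]; exact hU.mem_nhds hgU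
      exact this
    refine ⟨U, hU, hgU, fun x => s x - limUnder (leftNhds x) s, fun x hx => ?_, ?_⟩
    · filter_upwards [hs.1 x hx] with y hy
      rw [(Tendsto.mono_left hy (leftNhds_le y)).limUnder_eq, sub_self]
    · filter_upwards [hev, h.eventually_nhds] with g' hg' e
      obtain ⟨l, hl⟩ := (hs.2 (τ g') hg').1
      rw [(jump_eq hτ e hl).2, hl.limUnder_eq]
  · refine HasCompactSupport.mono' ht.2 fun g hg => ?_
    by_contra hn
    apply hg
    have h0 : ∀ᶠ g' in 𝓝 g, t g' = (fun _ : Circ => (0 : ℤ)) (τ g') :=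
      notMem_tsupport_iff_eventuallyEq.1 hn
    rw [(jump_eq hτ h0 tendsto_const_nhds).2, sub_self]

theorem jump_add (hτ : ∀ g, map τ (𝓝 g) = 𝓝 (τ g)) {t u : Y → ℤ}
    (ht : t ∈ (sheafS0.pullback τ).compactSections)
    (hu : u ∈ (sheafS0.pullback τ).compactSections) :
    jump τ (t + u) = jump τ t + jump τ u := by
  funext g
  obtain ⟨U, _, hgU, s, hs, h⟩ := ht.1 g (mem_univ g)
  obtain ⟨U', _, hgU', s', hs', h'⟩ := hu.1 g (mem_univ g)
  obtain ⟨l, hl⟩ := (hs.2 _ hgU).1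
  obtain ⟨l', hl'⟩ := (hs'.2 _ hgU').1
  have h'' : ∀ᶠ g' in 𝓝 g, (t + u) g' = (s + s') (τ g') := by
    filter_upwards [h, h'] with g' e e'
    simp [e, e']
  rw [Pi.add_apply, (jump_eq hτ h hl).2, (jump_eq hτ h' hl').2,
    (jump_eq hτ h'' (hl.add hl')).2, Pi.add_apply]
  ring

/-- The map `Γ_c(Y; τ^*𝒮⁰) → Γ_c(Y; τ^*𝒮¹)` induced by `∂ : 𝒮⁰ → 𝒮¹`. -/
def vert (hτ : ∀ g, map τ (𝓝 g) = 𝓝 (τ g)) :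
    (sheafS0.pullback τ).compactSections →+ (sheafS1.pullback τ).compactSections :=
  AddMonoidHom.mk' (fun t => ⟨jump τ t, jump_mem hτ t.2⟩) fun t u =>
    Subtype.ext (jump_add hτ t.2 u.2)

end Jump

/-! ### The transformation groupoid `ℤ ⋉ S¹` and its composable strings -/

/-- The space of arrows of `ℤ ⋉ S¹`, with the product topology. -/
abbrev Arrow : Type := ℤ × Circ

/-- The source of `(n, x)` is `x`. -/
def src (g : Arrow) : Circ := g.2

/-- The range of `(n, x)` is `x + nθ`. -/
def rng (θ : ℝ) (g : Arrow) : Circ := g.2 + g.1 • (θ : Circ)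

/-- The space of composable pairs `x₀ ← x₁ ← x₂`, with the subspace topology. -/
abbrev Pairs (θ : ℝ) : Type := {p : Arrow × Arrow // src p.1 = rng θ p.2}

/-- `(x₀ ← x₁ ← x₂) ↦ x₀`. -/
def rng2 (θ : ℝ) (p : Pairs θ) : Circ := rng θ p.1.1

/-- Omit `x₀`: `(g₁, g₂) ↦ g₂`. -/
def face0 (θ : ℝ) (p : Pairs θ) : Arrow := p.1.2

/-- Compose: `(g₁, g₂) ↦ g₁ g₂`, where `(m, x + nθ) (n, x) = (m + n, x)`. -/
def face1 (θ : ℝ) (p : Pairs θ) : Arrow := (p.1.1.1 + p.1.2.1, p.1.2.2)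

/-- Omit `x₂`: `(g₁, g₂) ↦ g₁`. -/
def face2 (θ : ℝ) (p : Pairs θ) : Arrow := p.1.1

theorem continuous_rng (θ : ℝ) : Continuous (rng θ) :=
  continuous_snd.add ((continuous_of_discreteTopology (f := fun n : ℤ => n • (θ : Circ))).comp
    continuous_fst)

theorem map_rng (θ : ℝ) (g : Arrow) : map (rng θ) (𝓝 g) = 𝓝 (rng θ g) := by
  obtain ⟨n, x⟩ := g
  rw [nhds_prod_eq, nhds_discrete, pure_prod, map_map]
  exact (Homeomorph.addRight (n • (θ : Circ))).map_nhds_eq x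

theorem map_id_nhds (x : Circ) : map (id : Circ → Circ) (𝓝 x) = 𝓝 (id x) := map_id

/-! ### The horizontal differential -/

/-- Summation over the fibres of `d`. -/
def fibreSum {X Y : Type*} (d : Y → X) (t : Y → ℤ) (h : X) : ℤ := ∑ᶠ (g : Y) (_ : d g = h), t g

section Push

variable {X Y D : Type*} [TopologicalSpace X] [TopologicalSpace Y] [TopologicalSpace D]

/-- A trivialization `Y ≅ X × D` over `X`, with `D` discrete, of a map `d : Y → X`; the maps `τY`
and `τX` to the circle differ by a constant rotation on each sheet. -/
structure Sheets (d : Y → X) (q : Y → D) (σ : D → X → Y) (τY : Y → Circ) (τX : X → Circ)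
    (c : D → Circ) : Prop where
  cont_d : Continuous d
  cont_q : Continuous q
  cont_σ : ∀ k, Continuous (σ k)
  d_σ : ∀ k h, d (σ k h) = h
  q_σ : ∀ k h, q (σ k h) = k
  σ_qd : ∀ g, σ (q g) (d g) = g
  τ_σ : ∀ k h, τY (σ k h) = τX h + c k

variable {d : Y → X} {q : Y → D} {σ : D → X → Y} {τY : Y → Circ} {τX : X → Circ} {c : D → Circ}

theorem Sheets.finite [DiscreteTopology D] (S : Sheets d q σ τY τX c) {t : Y → ℤ} (ht : HasCompactSupport t) :
    (q '' tsupport t).Finite :=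
  (IsCompact.image ht S.cont_q).finite_of_discrete

theorem Sheets.fibreSum_eq (S : Sheets d q σ τY τX c) {t : Y → ℤ} {A : Finset D}
    (hA : q '' tsupport t ⊆ A) (h : X) : fibreSum d t h = ∑ k ∈ A, t (σ k h) := by
  classical
  have hinj : Function.Injective (fun k => σ k h) := fun k k' e => by
    have := congrArg q e
    simpa [S.q_σ] using this
  unfold fibreSum
  have : ∀ g, (∑ᶠ (_ : d g = h), t g) = if d g = h then t g else 0 := fun g =>
    finsum_eq_if
  simp_rw [this]
  rw [finsum_eq_sum_of_support_subset (s := A.image (fun k => σ k h))]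
  · rw [Finset.sum_image (fun _ _ _ _ e => hinj e)]
    exact Finset.sum_congr rfl fun k _ => by simp [S.d_σ]
  · intro g hg
    simp only [Function.mem_support, ne_eq, ite_eq_right_iff, Classical.not_imp] at hg
    simp only [Finset.coe_image, mem_image]
    refine ⟨q g, hA ⟨g, subset_tsupport _ hg.2, rfl⟩, ?_⟩
    rw [← hg.1, S.σ_qd]

theorem Sheets.mem [T2Space Y] [DiscreteTopology D] (S : Sheets d q σ τY τX c) {F : IntSheaf Circ} (hF : RotationInvariant F)
    {t : Y → ℤ} (ht : t ∈ (F.pullback τY).compactSections) :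
    fibreSum d t ∈ (F.pullback τX).compactSections := by
  have hfin := S.finite ht.2
  have e : fibreSum d t = ∑ k ∈ hfin.toFinset, fun h => t (σ k h) := by
    funext h
    rw [S.fibreSum_eq (A := hfin.toFinset) (by simp) h, Finset.sum_apply]
  rw [e]
  refine AddSubgroup.sum_mem _ fun k _ => ⟨fun h _ => ?_, ?_⟩
  · obtain ⟨U, hU, hgU, s, hs, hts⟩ := ht.1 (σ k h) (mem_univ _)
    refine ⟨(fun x => x + c k) ⁻¹' U, hU.preimage (continuous_id.add continuous_const), ?_,
      fun x => s (x + c k), hF _ _ _ hs, ?_⟩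
    · rw [S.τ_σ] at hgU
      exact hgU
    · filter_upwards [(S.cont_σ k).continuousAt.eventually hts] with h' e'
      rw [e', S.τ_σ]
  · have hl : Function.LeftInverse d (σ k) := S.d_σ k
    exact ht.2.comp_isClosedEmbedding (hl.isClosedEmbedding S.cont_d (S.cont_σ k))

theorem Sheets.add [DiscreteTopology D] (S : Sheets d q σ τY τX c) {t u : Y → ℤ} (ht : HasCompactSupport t)
    (hu : HasCompactSupport u) : fibreSum d (t + u) = fibreSum d t + fibreSum d u := by
  classical
  funext h
  let A := (S.finite ht).toFinset ∪ (S.finite hu).toFinset ∪ (S.finite (ht.add hu)).toFinset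
  rw [Pi.add_apply, S.fibreSum_eq (A := A), S.fibreSum_eq (t := t) (A := A),
    S.fibreSum_eq (t := u) (A := A), ← Finset.sum_add_distrib]
  · rfl
  · intro k hk; simp [A, hk]
  · intro k hk; simp [A, hk]
  · intro k hk
    have : k ∈ (S.finite (ht.add hu)).toFinset := by simpa using hk
    exact Finset.mem_coe.2 (Finset.mem_union_right _ this)

/-- Summation over the fibres as a map `Γ_c(Y; τY^*F) → Γ_c(X; τX^*F)`. -/
def Sheets.push [T2Space Y] [DiscreteTopology D] (S : Sheets d q σ τY τX c) {F : IntSheaf Circ} (hF : RotationInvariant F) :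
    (F.pullback τY).compactSections →+ (F.pullback τX).compactSections :=
  AddMonoidHom.mk' (fun t => ⟨fibreSum d t, S.mem hF t.2⟩) fun t u =>
    Subtype.ext (S.add t.2.2 u.2.2)

end Push

theorem sheets_src (θ : ℝ) : Sheets src Prod.fst (fun (k : ℤ) (x : Circ) => ((k, x) : Arrow))
    (rng θ) id (fun k : ℤ => k • (θ : Circ)) where
  cont_d := continuous_snd
  cont_q := continuous_fst
  cont_σ k := by fun_prop
  d_σ _ _ := rfl
  q_σ _ _ := rfl
  σ_qd _ := rfl
  τ_σ _ _ := rfl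

theorem sheets_rng (θ : ℝ) : Sheets (rng θ) Prod.fst
    (fun (k : ℤ) (x : Circ) => ((k, x - k • (θ : Circ)) : Arrow)) (rng θ) id
    (fun _ : ℤ => 0) where
  cont_d := continuous_rng θ
  cont_q := continuous_fst
  cont_σ k := by fun_prop
  d_σ _ _ := by simp [rng]
  q_σ _ _ := rfl
  σ_qd g := by simp [rng]
  τ_σ _ _ := by simp [rng]

theorem sheets_face0 (θ : ℝ) : Sheets (face0 θ) (fun p => p.1.1.1)
    (fun (k : ℤ) (g : Arrow) => (⟨((k, rng θ g), g), rfl⟩ : Pairs θ)) (rng2 θ) (rng θ)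
    (fun k : ℤ => k • (θ : Circ)) where
  cont_d := by unfold face0; fun_prop
  cont_q := by fun_prop
  cont_σ k := by have := continuous_rng θ; fun_prop
  d_σ _ _ := rfl
  q_σ _ _ := rfl
  σ_qd p := by
    obtain ⟨⟨⟨m, x⟩, g⟩, h⟩ := p
    simp only [src] at h
    subst h
    rfl
  τ_σ _ _ := rfl

theorem sheets_face1 (θ : ℝ) : Sheets (face1 θ) (fun p => p.1.2.1)
    (fun (k : ℤ) (g : Arrow) => (⟨((g.1 - k, rng θ (k, g.2)), (k, g.2)), rfl⟩ : Pairs θ))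
    (rng2 θ) (rng θ) (fun _ : ℤ => 0) where
  cont_d := by unfold face1; fun_prop
  cont_q := by fun_prop
  cont_σ k := by
    have := continuous_rng θ
    have h : Continuous fun g : Arrow => rng θ (k, g.2) := this.comp (by fun_prop)
    have h' : Continuous fun g : Arrow => g.1 - k :=
      (continuous_of_discreteTopology (f := fun n : ℤ => n - k)).comp continuous_fst
    fun_prop
  d_σ _ _ := by simp [face1]
  q_σ _ _ := rfl
  σ_qd p := by
    obtain ⟨⟨⟨m, x⟩, n, y⟩, h⟩ := p
    simp only [src] at h
    subst h
    simp [face1]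
  τ_σ k g := by
    simp only [rng2, rng, add_zero]
    rw [add_assoc, ← add_smul]
    simp

theorem sheets_face2 (θ : ℝ) : Sheets (face2 θ) (fun p => p.1.2.1)
    (fun (k : ℤ) (g : Arrow) =>
      (⟨(g, (k, g.2 - k • (θ : Circ))), by simp [src, rng]⟩ : Pairs θ))
    (rng2 θ) (rng θ) (fun _ : ℤ => 0) where
  cont_d := by unfold face2; fun_prop
  cont_q := by fun_prop
  cont_σ k := by fun_prop
  d_σ _ _ := rfl
  q_σ _ _ := rfl
  σ_qd p := by
    obtain ⟨⟨⟨m, x⟩, n, y⟩, h⟩ := p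
    simp only [src, rng] at h
    subst h
    simp [face2]
  τ_σ k g := by simp [rng2]

/-! ### The chain groups in total degrees `1`, `0`, `-1` and the homology -/

/-- `Γ_c(𝒢⁽⁰⁾; 𝒮⁰₀)`. -/
abbrev C00 : Type := sheafS0.compactSections

/-- `Γ_c(𝒢⁽⁰⁾; 𝒮¹₀)`. -/
abbrev C01 : Type := sheafS1.compactSections

/-- `Γ_c(𝒢⁽¹⁾; 𝒮⁰₁)`. -/
abbrev C10 (θ : ℝ) : Type := (sheafS0.pullback (rng θ)).compactSections

/-- `Γ_c(𝒢⁽¹⁾; 𝒮¹₁)`. -/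
abbrev C11 (θ : ℝ) : Type := (sheafS1.pullback (rng θ)).compactSections

/-- `Γ_c(𝒢⁽²⁾; 𝒮¹₂)`. -/
abbrev C21 (θ : ℝ) : Type := (sheafS1.pullback (rng2 θ)).compactSections

/-- A sheaf has the same sections as its pullback along the identity. -/
def pullbackId {X : Type*} [TopologicalSpace X] (F : IntSheaf X) :
    (F.pullback id).compactSections ≃+ F.compactSections :=
  AddEquiv.addSubgroupCongr (by
    ext t
    exact and_congr IntSheaf.mem_pullback_id Iff.rfl)

/-- `∂ : Γ_c(𝒢⁽⁰⁾; 𝒮⁰₀) → Γ_c(𝒢⁽⁰⁾; 𝒮¹₀)`. -/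
def vert0 : C00 →+ C01 :=
  (pullbackId sheafS1).toAddMonoidHom.comp
    ((vert map_id_nhds).comp (pullbackId sheafS0).symm.toAddMonoidHom)

/-- `∂ : Γ_c(𝒢⁽¹⁾; 𝒮⁰₁) → Γ_c(𝒢⁽¹⁾; 𝒮¹₁)`. -/
def vert1 (θ : ℝ) : C10 θ →+ C11 θ := vert (map_rng θ)

/-- `δ : Γ_c(𝒢⁽¹⁾; F₁) → Γ_c(𝒢⁽⁰⁾; F₀)`, the sum over `s⁻¹(x)` minus the sum over `r⁻¹(x)`. -/
def horiz1 (θ : ℝ) {F : IntSheaf Circ} (hF : RotationInvariant F) :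
    (F.pullback (rng θ)).compactSections →+ F.compactSections :=
  (pullbackId F).toAddMonoidHom.comp ((sheets_src θ).push hF - (sheets_rng θ).push hF)

/-- `δ = δ₀ - δ₁ + δ₂ : Γ_c(𝒢⁽²⁾; F₂) → Γ_c(𝒢⁽¹⁾; F₁)`. -/
def horiz2 (θ : ℝ) {F : IntSheaf Circ} (hF : RotationInvariant F) :
    (F.pullback (rng2 θ)).compactSections →+ (F.pullback (rng θ)).compactSections :=
  (sheets_face0 θ).push hF - (sheets_face1 θ).push hF + (sheets_face2 θ).push hF

/-- The total differential from degree `0` to degree `-1`, `(a, b) ↦ ∂a + δb`. -/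
def total0 (θ : ℝ) : C00 × C11 θ →+ C01 :=
  vert0.coprod (horiz1 θ sheafS1_rotationInvariant)

/-- The total differential from degree `1` to degree `0`, `(e, c) ↦ (δe, -∂e + δc)`; the vertical
differential carries the sign `(-1)^p` in column `p`. -/
def total1 (θ : ℝ) : C10 θ × C21 θ →+ C00 × C11 θ :=
  ((horiz1 θ sheafS0_rotationInvariant).prod (-vert1 θ)).coprod
    ((0 : C21 θ →+ C00).prod (horiz2 θ sheafS1_rotationInvariant))

/-- The `0`-cycles. -/
abbrev Cycles (θ : ℝ) : AddSubgroup (C00 × C11 θ) := (total0 θ).ker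

/-- The groupoid homology group `H₀(ℤ ⋉ S¹)`: cycles modulo boundaries. -/
abbrev H0 (θ : ℝ) : Type := Cycles θ ⧸ (total1 θ).range.addSubgroupOf (Cycles θ)

/-- The homology class of a `0`-cycle. -/
def H0.cls {θ : ℝ} (z : Cycles θ) : H0 θ := QuotientAddGroup.mk z

/-- The cohomology group `H⁰(S¹)`. -/
abbrev CohZero : AddSubgroup C00 := vert0.ker

/-- The cohomology group `H¹(S¹)`. -/
abbrev CohOne : Type := C01 ⧸ vert0.range

/-- The class in `H¹(S¹)` of a section of `𝒮¹`. -/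
def CohOne.cls (b : C01) : CohOne := QuotientAddGroup.mk b

/-! ### The sections entering the explicit maps -/

/-- `b₁(m, x) = b(x)` if `m = 1`, and `0` otherwise. -/
def sliceOne (θ : ℝ) (b : C01) : C11 θ :=
  ⟨fun g => if g.1 = 1 then b.1 g.2 else 0, by
    constructor
    · rintro ⟨n, x⟩ -
      have hn : ∀ᶠ g' : Arrow in 𝓝 (n, x), g'.1 = n := by
        have : ∀ᶠ m in 𝓝 n, m = n := by simp [nhds_discrete]
        exact (continuous_fst.tendsto (n, x)).eventually this
      by_cases h : n = 1
      · refine ⟨univ, isOpen_univ, mem_univ _, fun y => b.1 (y + -(θ : Circ)),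
          sheafS1_rotationInvariant (-(θ : Circ)) univ b.1 b.2.1, ?_⟩
        filter_upwards [hn] with g' e
        simp [e, h, rng]
      · refine ⟨univ, isOpen_univ, mem_univ _, 0, (sheafS1.sec _).zero_mem, ?_⟩
        filter_upwards [hn] with g' e
        simp [e, h]
    · refine HasCompactSupport.intro (K := ({1} : Set ℤ) ×ˢ (univ : Set Circ))
        (isCompact_singleton.prod isCompact_univ) fun g hg => ?_
      have : g.1 ≠ 1 := fun h => hg ⟨h, mem_univ _⟩
      simp [this]⟩

/-- The constant function `1`. -/
def oneSection : C00 :=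
  ⟨fun _ => 1, ⟨fun _ _ => Eventually.of_forall fun _ => continuousAt_const,
    fun _ _ => ⟨⟨1, tendsto_const_nhds⟩, tendsto_const_nhds⟩⟩,
    HasCompactSupport.of_compactSpace _⟩

open Classical in
/-- The function with value `1` at `0` and `0` elsewhere. -/
def pointSection : C01 :=
  ⟨fun x => if x = 0 then 1 else 0, by
    refine ⟨fun x _ => ?_, HasCompactSupport.of_compactSpace _⟩
    by_cases h : x = 0
    · subst h
      filter_upwards [self_mem_nhdsWithin] with y hy
      exact if_neg hy
    · filter_upwards [mem_nhdsWithin_of_mem_nhds (isOpen_ne.mem_nhds h)] with y hy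
      exact if_neg hy⟩

/-- The conditions that determine `a_b`: `∂(a_b) = b - α(b)`, where `α(b)(x) = b(x - θ)`, and
`a_b(0)` is the sum of the values of `b` on the arc `(-θ, 0]`. -/
def IsPrimitive (θ : ℝ) (b : C01) (a : C00) : Prop :=
  (∀ x : Circ, (vert0 a).1 x = b.1 x - b.1 (x - (θ : Circ))) ∧
    a.1 0 = ∑ᶠ (t : ℝ) (_ : t ∈ Ico 0 θ), b.1 (-(t : Circ))

/-! ### The resolution, and invariant measures -/

/-- `0 → 𝒵 → 𝒮⁰ → 𝒮¹ → 0` is an exact sequence of sheaves, with `∂` the second map, and `𝒮⁰`,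
`𝒮¹` are equivariant and `c`-soft. -/
def IsSoftResolution : Prop :=
  RotationInvariant sheafS0 ∧ RotationInvariant sheafS1 ∧
  sheafS0.IsCSoft ∧ sheafS1.IsCSoft ∧
  (∀ (U : Set Circ) (s : Circ → ℤ), IsOpen U →
    (s ∈ sheafZ.sec U ↔ s ∈ sheafS0.sec U ∧ ∀ x ∈ U, jump id s x = 0)) ∧
  (∀ (U : Set Circ) (s : Circ → ℤ), IsOpen U → s ∈ sheafS0.sec U → jump id s ∈ sheafS1.sec U) ∧
  (∀ (U : Set Circ) (u : Circ → ℤ), IsOpen U → u ∈ sheafS1.sec U → ∀ x ∈ U,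
    ∃ V : Set Circ, IsOpen V ∧ x ∈ V ∧ V ⊆ U ∧ ∃ s ∈ sheafS0.sec V, EqOn (jump id s) u V)

/-- A measure `μ` on the unit space is invariant if `r^*μ = s^*μ`, as functionals on `C_c(𝒢)`. -/
def IsInvariant (θ : ℝ) (μ : Measure Circ) : Prop :=
  ∀ f : Arrow → ℝ, Continuous f → HasCompactSupport f →
    ∫ x, (∑ᶠ (g : Arrow) (_ : rng θ g = x), f g) ∂μ =
      ∫ x, (∑ᶠ (g : Arrow) (_ : src g = x), f g) ∂μ

end RotationGroupoid

end

open RotationGroupoid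

namespace RotationGroupoid

/-! ### One-sided neighbourhoods on the circle -/

/-! The groups $H^0(S^1)$ and $H^1(S^1)$ are generated by the constant $1$ and by a point mass: a
section of $\mathcal S^0$ without jumps is constant by connectedness, and the indicator of $[0,u)$
has jump $\delta_0-\delta_u$, so all point masses are cohomologous (`vert0_arcSection`,
`exists_sub_zsmul_point_mem_range`).

Surjectivity of $\phi_0\oplus\phi_1$ is a reduction to one sheet. A section on the component $(m,n)$
of $\mathcal G^{(2)}$ has a boundary relating the sheets $n$, $m+n$ and $m$ (`horiz2_pairSlice`).
Induction on the sheet then moves any $b$ to the sheet $1$ modulo boundaries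
(`exists_sub_slice_one_mem_range`). A cycle $(a,v_1)$ satisfies $\partial a=-(v-\alpha(v))$, so $a$
differs from the primitive of $-v$ by a constant, that is, by an element of $H^0(S^1)$.

Everything else rests on the pairing with Lebesgue measure. It vanishes on boundaries because
$\delta$ is a sum of terms $u-u(\cdot-n\theta)$ (`integralHom_horiz1`). It takes the values $1$ and
$\theta$ on the two generators, since the primitive of a point mass is the indicator of an arc of
length $\theta$ (`isPrimitive_point`). As $n+k\theta=0$ forces $n=k=0$, this gives injectivity and
shows that the class of the point mass has infinite order. The same irrationality argument makes
$\phi_1$ vanish on coboundaries (`isPrimitive_vert0`).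

For measures, invariance under $n\theta$ extends to all rotations by density of the orbit, and Haar
measure is unique. -/

theorem map_add_coe_nhds (x : Circ) (t : ℝ) :
    map (fun t : ℝ => x + (t : Circ)) (𝓝 t) = 𝓝 (x + (t : Circ)) := by
  have h := (AddCircle.isLocalHomeomorph_coe (1 : ℝ)).map_nhds_eq t
  have h' := (Homeomorph.addLeft x).map_nhds_eq (t : Circ)
  rw [← h, map_map] at h'
  exact h'

theorem eventually_leftNhds {x : Circ} {P : Circ → Prop} :
    (∀ᶠ y in leftNhds x, P y) ↔ ∀ᶠ t : ℝ in 𝓝[<] 0, P (x + (t : Circ)) := Iff.rfl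

theorem eventually_rightNhds {x : Circ} {P : Circ → Prop} :
    (∀ᶠ y in rightNhds x, P y) ↔ ∀ᶠ t : ℝ in 𝓝[>] 0, P (x + (t : Circ)) := Iff.rfl

/-- A property that holds on a one-sided interval at $x$ holds near each point of its interior. This
turns one-sided limits into local constancy at nearby points. -/
theorem eventually_leftNhds_nhds {x : Circ} {P : Circ → Prop} (h : ∀ᶠ y in leftNhds x, P y) :
    ∀ᶠ y in leftNhds x, ∀ᶠ z in 𝓝 y, P z := by
  rw [eventually_leftNhds] at h ⊢
  filter_upwards [eventually_eventually_nhdsWithin.2 h, self_mem_nhdsWithin] with t ht ht0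
  rw [isOpen_Iio.nhdsWithin_eq ht0] at ht
  rw [← map_add_coe_nhds]
  exact ht

theorem eventually_rightNhds_nhds {x : Circ} {P : Circ → Prop} (h : ∀ᶠ y in rightNhds x, P y) :
    ∀ᶠ y in rightNhds x, ∀ᶠ z in 𝓝 y, P z := by
  rw [eventually_rightNhds] at h ⊢
  filter_upwards [eventually_eventually_nhdsWithin.2 h, self_mem_nhdsWithin] with t ht ht0
  rw [isOpen_Ioi.nhdsWithin_eq ht0] at ht
  rw [← map_add_coe_nhds]
  exact ht

theorem punctured_le_sup (x : Circ) : 𝓝[≠] x ≤ leftNhds x ⊔ rightNhds x := by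
  intro s hs
  obtain ⟨h1, h2⟩ := mem_sup.1 hs
  have h : ∀ᶠ t : ℝ in 𝓝 0, t ≠ 0 → x + (t : Circ) ∈ s := by
    have : ∀ᶠ t : ℝ in 𝓝[≠] 0, x + (t : Circ) ∈ s := by
      rw [← Iio_union_Ioi, nhdsWithin_union]
      exact mem_sup.2 ⟨h1, h2⟩
    exact eventually_nhdsWithin_iff.1 this
  rw [mem_nhdsWithin_iff_eventually]
  have := map_add_coe_nhds x 0
  simp only [AddCircle.coe_zero, add_zero] at this
  rw [← this, eventually_map]
  filter_upwards [h] with t ht hne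
  exact ht fun h0 => hne (by simp [h0])

theorem eventually_nhds_of_sides {x : Circ} {P : Circ → Prop} (hl : ∀ᶠ y in leftNhds x, P y)
    (hr : ∀ᶠ y in rightNhds x, P y) (hx : P x) : ∀ᶠ y in 𝓝 x, P y := by
  have h : ∀ᶠ y in 𝓝[≠] x, P y := punctured_le_sup x (mem_sup.2 ⟨hl, hr⟩)
  rw [eventually_nhdsWithin_iff] at h
  filter_upwards [h] with y hy
  by_cases e : y = x
  · rwa [e]
  · exact hy e

/-! ### Sections of `𝒮⁰` -/

theorem tendsto_int_iff {α : Type*} {f : Filter α} {s : α → ℤ} {l : ℤ} :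
    Tendsto s f (𝓝 l) ↔ ∀ᶠ y in f, s y = l := by
  rw [nhds_discrete, tendsto_pure]

/-- Discreteness of the discontinuities is automatic: an integer-valued function with one-sided
limits is constant on a short interval on either side of each point, hence continuous throughout a
punctured neighbourhood. -/
theorem mem_sheafS0_iff {U : Set Circ} {s : Circ → ℤ} :
    s ∈ sheafS0.sec U ↔ ∀ x ∈ U, (∃ l : ℤ, ∀ᶠ y in leftNhds x, s y = l) ∧
      ∀ᶠ y in rightNhds x, s y = s x := by
  constructor
  · intro h x hx
    obtain ⟨⟨l, hl⟩, hr⟩ := h.2 x hx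
    exact ⟨⟨l, tendsto_int_iff.1 hl⟩, tendsto_int_iff.1 hr⟩
  · intro h
    refine ⟨fun x hx => ?_, fun x hx => ?_⟩
    · obtain ⟨⟨l, hl⟩, hr⟩ := h x hx
      have key : ∀ (y : Circ) (c : ℤ), (∀ᶠ z in 𝓝 y, s z = c) → ContinuousAt s y := by
        intro y c hy
        exact continuousAt_const.congr (hy.mono fun z hz => hz.symm)
      exact punctured_le_sup x (mem_sup.2
        ⟨(eventually_leftNhds_nhds hl).mono fun y hy => key y _ hy,
          (eventually_rightNhds_nhds hr).mono fun y hy => key y _ hy⟩)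
    · obtain ⟨⟨l, hl⟩, hr⟩ := h x hx
      exact ⟨⟨l, tendsto_int_iff.2 hl⟩, tendsto_int_iff.2 hr⟩

/-- The ring structure on $\mathcal S^0$ is what allows sections to be multiplied by cutoffs. -/
theorem sheafS0_mul_mem {U : Set Circ} {s t : Circ → ℤ} (hs : s ∈ sheafS0.sec U)
    (ht : t ∈ sheafS0.sec U) : s * t ∈ sheafS0.sec U := by
  rw [mem_sheafS0_iff] at *
  intro x hx
  obtain ⟨⟨l, hl⟩, hr⟩ := hs x hx
  obtain ⟨⟨l', hl'⟩, hr'⟩ := ht x hx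
  refine ⟨⟨l * l', ?_⟩, ?_⟩
  · filter_upwards [hl, hl'] with y e e'
    simp [e, e']
  · filter_upwards [hr, hr'] with y e e'
    simp [e, e']

theorem const_mem_sheafS0 (n : ℤ) (U : Set Circ) : (fun _ => n) ∈ sheafS0.sec U :=
  mem_sheafS0_iff.2 fun _ _ => ⟨⟨n, Eventually.of_forall fun _ => rfl⟩,
    Eventually.of_forall fun _ => rfl⟩

theorem jump_id_eq {s : Circ → ℤ} {x : Circ} {l : ℤ} (hl : ∀ᶠ y in leftNhds x, s y = l) :
    jump id s x = s x - l :=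
  (jump_eq (s := s) map_id_nhds (Eventually.of_forall fun _ => rfl) (tendsto_int_iff.2 hl)).2

theorem jump_id_mem {U : Set Circ} {s : Circ → ℤ} (hs : s ∈ sheafS0.sec U) :
    jump id s ∈ sheafS1.sec U := by
  intro x hx
  filter_upwards [hs.1 x hx] with y hy
  rw [jump_id_eq (tendsto_int_iff.1 (Tendsto.mono_left hy (leftNhds_le y))), sub_self]

theorem mem_sheafZ_iff {U : Set Circ} {s : Circ → ℤ} :
    s ∈ sheafZ.sec U ↔ s ∈ sheafS0.sec U ∧ ∀ x ∈ U, jump id s x = 0 := by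
  rw [mem_sheafS0_iff]
  constructor
  · intro h
    refine ⟨fun x hx => ⟨⟨s x, (h x hx).filter_mono (leftNhds_le x)⟩,
      (h x hx).filter_mono (rightNhds_le x)⟩, fun x hx => ?_⟩
    rw [jump_id_eq ((h x hx).filter_mono (leftNhds_le x)), sub_self]
  · rintro ⟨h, hj⟩ x hx
    obtain ⟨⟨l, hl⟩, hr⟩ := h x hx
    have := hj x hx
    rw [jump_id_eq hl, sub_eq_zero] at this
    exact eventually_nhds_of_sides (this ▸ hl) hr rfl

/-! ### Indicator functions of arcs -/

/-- The indicator function of the arc `[0, c)`, for `0 ≤ c < 1`. -/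
noncomputable def arc (c : ℝ) : Circ → ℤ :=
  Function.Periodic.lift (f := fun u : ℝ => ⌊u⌋ - ⌊u - c⌋) (c := 1) fun u => by
    have : u + 1 - c = (u - c) + 1 := by ring
    simp only [this, Int.floor_add_one]
    ring

theorem arc_coe (c u : ℝ) : arc c (u : Circ) = ⌊u⌋ - ⌊u - c⌋ := rfl

theorem arc_coe_of_mem {c u : ℝ} (h0 : 0 ≤ c) (h1 : c < 1) (hu : u ∈ Ico (0 : ℝ) 1) :
    arc c (u : Circ) = if u < c then 1 else 0 := by
  rw [arc_coe, Int.floor_eq_zero_iff.2 hu]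
  split_ifs with h
  · have : ⌊u - c⌋ = -1 := by
      rw [Int.floor_eq_iff]; push_cast; constructor <;> linarith [hu.1]
    rw [this]; rfl
  · have : ⌊u - c⌋ = 0 := by
      rw [Int.floor_eq_iff]; push_cast; constructor <;> linarith [hu.1, hu.2, not_lt.1 h]
    rw [this]; rfl

/-- The left limit of the floor at $u$ is $\lceil u\rceil-1$, which differs from $\lfloor u\rfloor$
exactly at integers. Applied at $u$ and $u-c$, it yields both jumps of `arc c`. -/
theorem floor_left (u : ℝ) :
    ∀ᶠ t : ℝ in 𝓝[<] 0, ⌊u + t⌋ = ⌊u⌋ - if (u : Circ) = 0 then 1 else 0 := by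
  have h : Tendsto (fun t : ℝ => u + t) (𝓝[<] 0) (𝓝[<] u) := by
    refine tendsto_nhdsWithin_iff.2 ⟨?_, ?_⟩
    · have : Tendsto (fun t : ℝ => u + t) (𝓝 0) (𝓝 (u + 0)) :=
        (continuous_const.add continuous_id).tendsto 0
      rw [add_zero] at this
      exact this.mono_left nhdsWithin_le_nhds
    · filter_upwards [self_mem_nhdsWithin] with t ht
      simpa using ht
  have h2 := tendsto_pure.1 ((tendsto_floor_left_pure_ceil_sub_one u).comp h)
  filter_upwards [h2] with t ht
  rw [Function.comp] at ht
  rw [ht]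
  split_ifs with hu
  · obtain ⟨n, hn⟩ := AddCircle.coe_eq_zero_iff 1 |>.1 hu
    simp only [zsmul_eq_mul, mul_one] at hn
    rw [← hn]; simp
  · have : ⌈u⌉ = ⌊u⌋ + 1 := by
      rw [Int.ceil_eq_floor_add_one_iff_notMem]
      rintro ⟨n, hn⟩
      exact hu ((AddCircle.coe_eq_zero_iff 1).2 ⟨n, by simpa using hn⟩)
    omega

theorem floor_right (u : ℝ) : ∀ᶠ t : ℝ in 𝓝[>] 0, ⌊u + t⌋ = ⌊u⌋ := by
  have h : Tendsto (fun t : ℝ => u + t) (𝓝[>] 0) (𝓝[≥] u) := by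
    refine tendsto_nhdsWithin_iff.2 ⟨?_, ?_⟩
    · have : Tendsto (fun t : ℝ => u + t) (𝓝 0) (𝓝 (u + 0)) :=
        (continuous_const.add continuous_id).tendsto 0
      rw [add_zero] at this
      exact this.mono_left nhdsWithin_le_nhds
    · filter_upwards [self_mem_nhdsWithin] with t ht
      have : (0 : ℝ) < t := ht
      simp [this.le]
  exact tendsto_pure.1 ((tendsto_floor_right_pure_floor u).comp h)

open Classical in
theorem arc_left (c : ℝ) (x : Circ) : ∀ᶠ y in leftNhds x,
    arc c y = arc c x - ((if x = 0 then 1 else 0) - if x = (c : Circ) then 1 else 0) := by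
  obtain ⟨u, rfl⟩ := QuotientAddGroup.mk_surjective x
  change ∀ᶠ y in leftNhds (u : Circ), arc c y = arc c (u : Circ) -
    ((if (u : Circ) = 0 then 1 else 0) - if (u : Circ) = (c : Circ) then 1 else 0)
  rw [eventually_leftNhds]
  filter_upwards [floor_left u, floor_left (u - c)] with t e e'
  rw [← AddCircle.coe_add, arc_coe, arc_coe, e]
  have : u + t - c = u - c + t := by ring
  rw [this, e', AddCircle.coe_sub]
  simp only [sub_eq_zero]
  ring

theorem arc_mem (c : ℝ) : arc c ∈ sheafS0.sec univ := by
  classical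
  refine mem_sheafS0_iff.2 fun x _ => ⟨⟨_, arc_left c x⟩, ?_⟩
  obtain ⟨u, rfl⟩ := QuotientAddGroup.mk_surjective x
  rw [eventually_rightNhds]
  filter_upwards [floor_right u, floor_right (u - c)] with t e e'
  rw [← AddCircle.coe_add, arc_coe, arc_coe, e]
  have : u + t - c = u - c + t := by ring
  rw [this, e']

open Classical in
theorem jump_arc (c : ℝ) (x : Circ) : jump id (arc c) x =
    (if x = 0 then 1 else 0) - if x = (c : Circ) then 1 else 0 := by
  rw [jump_id_eq (arc_left c x)]
  ring

/-- The section `y ↦ s (y - p)`. -/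
theorem comp_sub_mem_sheafS0 {s : Circ → ℤ} (hs : s ∈ sheafS0.sec univ) (p : Circ) :
    (fun y => s (y - p)) ∈ sheafS0.sec univ := by
  simpa only [sub_eq_add_neg, preimage_univ] using sheafS0_rotationInvariant (-p) univ s hs

theorem jump_comp_sub {s : Circ → ℤ} (hs : s ∈ sheafS0.sec univ) (p x : Circ) :
    jump id (fun y => s (y - p)) x = jump id s (x - p) := by
  obtain ⟨l, hl⟩ := ((mem_sheafS0_iff.1 hs) (x - p) (mem_univ _)).1
  rw [jump_id_eq hl]
  refine jump_id_eq ?_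
  have := tendsto_left (-p) x
  simp only [← sub_eq_add_neg] at this
  exact this.eventually hl

/-! ### The soft resolution -/

/-- Sections of $\mathcal S^1$ need no regularity, so they may be cut off by any set; a closed set
inside $U$ prevents the support from accumulating on the boundary of $U$. -/
theorem sheafS1_isCSoft : sheafS1.IsCSoft := by
  classical
  intro K U hK hU hKU s hs
  obtain ⟨V, hV, hKV, hVU⟩ := normal_exists_closure_subset hK.isClosed hU hKU
  refine ⟨V, hV, hKV, subset_closure.trans hVU, indicator (closure V) s, fun x _ => ?_,
    fun y hy => (indicator_of_mem (subset_closure hy) s).symm⟩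
  by_cases hx : x ∈ closure V
  · filter_upwards [hs x (hVU hx)] with y hy
    by_cases h : y ∈ closure V <;> simp [h, hy]
  · filter_upwards [mem_nhdsWithin_of_mem_nhds (isClosed_closure.isOpen_compl.mem_nhds hx)]
      with y hy
    exact indicator_of_notMem hy s

theorem exists_local_cutoff {U : Set Circ} (hU : IsOpen U) {x : Circ} (hx : x ∈ U) :
    ∃ χ ∈ sheafS0.sec univ, (∀ᶠ y in 𝓝 x, χ y = 1) ∧ tsupport χ ⊆ U := by
  obtain ⟨ε, hε, hεU⟩ := Metric.isOpen_iff.1 hU x hx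
  -- The cutoff is the indicator of $[x-\delta,x+\delta)$. The bound $1/4$ keeps its length
  -- $2\delta$ below $1$, and $\varepsilon/2$ keeps its closure inside the ball.
  set δ : ℝ := min (ε / 2) (1 / 4) with hδ
  have hδ0 : 0 < δ := by positivity
  have hδ1 : δ ≤ 1 / 4 := min_le_right _ _
  have hδε : δ ≤ ε / 2 := min_le_left _ _
  have hmem := comp_sub_mem_sheafS0 (arc_mem (2 * δ)) (x - (δ : Circ))
  refine ⟨_, hmem, ?_, ?_⟩
  · have := map_add_coe_nhds x 0
    simp only [AddCircle.coe_zero, add_zero] at this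
    rw [← this, eventually_map]
    filter_upwards [Ioo_mem_nhds (neg_lt_zero.2 hδ0) hδ0] with t ht
    have e : x + (t : Circ) - (x - (δ : Circ)) = ((t + δ : ℝ) : Circ) := by
      rw [AddCircle.coe_add]; abel
    rw [e, arc_coe_of_mem (by linarith) (by linarith)
      ⟨by linarith [ht.1], by linarith [ht.2]⟩, if_pos (by linarith [ht.2])]
  · refine Subset.trans ?_ hεU
    have hsub : Function.support (fun y => arc (2 * δ) (y - (x - (δ : Circ)))) ⊆
        Metric.closedBall x δ := by
      intro y hy
      obtain ⟨u, hu, e⟩ : ∃ u ∈ Ico (0 : ℝ) 1, (u : Circ) = y - (x - (δ : Circ)) := by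
        have := AddCircle.coe_image_Ico_eq (1 : ℝ) 0
        have h : y - (x - (δ : Circ)) ∈ (univ : Set Circ) := mem_univ _
        rw [← this, zero_add] at h
        exact h
      simp only [Function.mem_support, ← e] at hy
      rw [arc_coe_of_mem (by linarith) (by linarith) hu] at hy
      have hlt : u < 2 * δ := by
        by_contra h
        simp [h] at hy
      rw [mem_closedBall_iff_norm]
      have e' : y - x = ((u - δ : ℝ) : Circ) := by
        rw [AddCircle.coe_sub, e]; abel
      rw [e']
      refine (QuotientAddGroup.norm_mk_le_norm).trans ?_
      rw [Real.norm_eq_abs, abs_le]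
      constructor <;> linarith [hu.1]
    refine (closure_minimal hsub Metric.isClosed_closedBall).trans ?_
    exact Metric.closedBall_subset_ball (by linarith)

theorem exists_cutoff {K U : Set Circ} (hK : IsCompact K) (hU : IsOpen U) (hKU : K ⊆ U) :
    ∃ χ ∈ sheafS0.sec univ, (∀ x ∈ K, ∀ᶠ y in 𝓝 x, χ y = 1) ∧ tsupport χ ⊆ U := by
  refine hK.induction_on (p := fun S => ∃ χ ∈ sheafS0.sec univ,
    (∀ x ∈ S, ∀ᶠ y in 𝓝 x, χ y = 1) ∧ tsupport χ ⊆ U) ?_ ?_ ?_ ?_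
  · exact ⟨0, (sheafS0.sec _).zero_mem, by simp, by simp [tsupport]⟩
  · rintro s t hst ⟨χ, h, h', h''⟩
    exact ⟨χ, h, fun x hx => h' x (hst hx), h''⟩
  · rintro s t ⟨χ, h, h', h''⟩ ⟨ψ, g, g', g''⟩
    -- This is $1-(1-\chi)(1-\psi)$, which equals $1$ wherever either cutoff does.
    refine ⟨χ + ψ - χ * ψ, (sheafS0.sec _).sub_mem ((sheafS0.sec _).add_mem h g)
      (sheafS0_mul_mem h g), ?_, ?_⟩
    · rintro x (hx | hx)
      · filter_upwards [h' x hx] with y hy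
        simp [hy]
      · filter_upwards [g' x hx] with y hy
        simp [hy]
    · refine (closure_minimal ?_ ((isClosed_tsupport χ).union (isClosed_tsupport ψ))).trans
        (union_subset h'' g'')
      intro y hy
      by_contra hn
      rw [mem_union, not_or] at hn
      exact hy (by simp [image_eq_zero_of_notMem_tsupport hn.1,
        image_eq_zero_of_notMem_tsupport hn.2])
  · intro x hx
    obtain ⟨χ, h, h', h''⟩ := exists_local_cutoff hU (hKU hx)
    exact ⟨{y | ∀ᶠ z in 𝓝 y, χ z = 1}, mem_nhdsWithin_of_mem_nhds (eventually_eventually_nhds.2 h'),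
      χ, h, fun y hy => hy, h''⟩

theorem sheafS0_isCSoft : sheafS0.IsCSoft := by
  intro K U hK hU hKU s hs
  obtain ⟨χ, hχ, h1, h2⟩ := exists_cutoff hK hU hKU
  refine ⟨{y | ∀ᶠ z in 𝓝 y, χ z = 1} ∩ U, isOpen_setOfPred_eventually_nhds.inter hU,
    fun x hx => ⟨h1 x hx, hKU hx⟩, inter_subset_right, χ * s, ?_, ?_⟩
  · refine sheafS0.glue fun x _ => ?_
    by_cases hx : x ∈ U
    · exact ⟨U, hU, hx, sheafS0_mul_mem (sheafS0.res (subset_univ _) hχ) hs⟩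
    · refine ⟨(tsupport χ)ᶜ, (isClosed_tsupport χ).isOpen_compl, fun h => hx (h2 h), ?_⟩
      refine sheafS0.congr (isClosed_tsupport χ).isOpen_compl (s := 0) ?_
        (sheafS0.sec _).zero_mem
      intro y hy
      simp [image_eq_zero_of_notMem_tsupport hy]
  · intro y hy
    have : χ y = 1 := hy.1.self_of_nhds
    simp [this]

/-- Near $x$ the section $u$ is $u(x)$ times a point mass. The arc $[x,x+1/2)$ has jump $1$ at $x$;
its other jump is avoided by deleting the endpoint $x+1/2$ from $V$. -/
theorem exists_local_primitive {U : Set Circ} (hU : IsOpen U) {u : Circ → ℤ}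
    (hu : u ∈ sheafS1.sec U) {x : Circ} (hx : x ∈ U) :
    ∃ V : Set Circ, IsOpen V ∧ x ∈ V ∧ V ⊆ U ∧ ∃ s ∈ sheafS0.sec V, EqOn (jump id s) u V := by
  classical
  obtain ⟨W, hW, hWo, hxW⟩ := eventually_nhds_iff.1 (eventually_nhdsWithin_iff.1 (hu x hx))
  have hne : ((1 / 2 : ℝ) : Circ) ≠ 0 := by
    intro h
    obtain ⟨n, hn⟩ := (AddCircle.coe_eq_zero_iff 1).1 h
    simp only [zsmul_eq_mul, mul_one] at hn
    have h2 : (2 * n : ℝ) = 1 := by rw [hn]; norm_num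
    have h3 : 2 * n = 1 := by exact_mod_cast h2
    omega
  have hmem := comp_sub_mem_sheafS0 (arc_mem (1 / 2)) x
  refine ⟨(U ∩ W) ∩ {y | y ≠ x + ((1 / 2 : ℝ) : Circ)}, (hU.inter hWo).inter isOpen_ne,
    ⟨⟨hx, hxW⟩, ?_⟩, fun y hy => hy.1.1, fun y => u x * arc (1 / 2) (y - x), ?_, ?_⟩
  · simpa using hne
  · exact sheafS0.res (subset_univ _) (sheafS0_mul_mem (const_mem_sheafS0 (u x) univ) hmem)
  · rintro y ⟨⟨_, hyW⟩, hy⟩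
    obtain ⟨l, hl⟩ := (mem_sheafS0_iff.1 hmem y (mem_univ y)).1
    have e1 := jump_id_eq hl
    rw [jump_comp_sub (arc_mem _), jump_arc] at e1
    have e2 : jump id (fun y => u x * arc (1 / 2) (y - x)) y =
        u x * arc (1 / 2) (y - x) - u x * l :=
      jump_id_eq (hl.mono fun z hz => by rw [hz])
    rw [e2, ← mul_sub, ← e1]
    have hy' : ¬ (y - x = ((1 / 2 : ℝ) : Circ)) := fun h => hy (by
      rw [← h]; abel)
    rw [if_neg hy']
    by_cases hyx : y = x
    · simp [hyx]
    · rw [if_neg (sub_ne_zero.2 hyx), hW y hyW hyx]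
      ring

theorem isSoftResolution : IsSoftResolution :=
  ⟨sheafS0_rotationInvariant, sheafS1_rotationInvariant, sheafS0_isCSoft, sheafS1_isCSoft,
    fun _ _ _ => mem_sheafZ_iff, fun _ _ _ hs => jump_id_mem hs,
    fun _ _ hU hu _ hx => exists_local_primitive hU hu hx⟩

/-! ### Global sections on the circle -/

/-- Translation of sections, `(shift c s)(x) = s (x - c)`. -/
def shift {F : IntSheaf Circ} (hF : RotationInvariant F) (c : Circ) :
    F.compactSections →+ F.compactSections where
  toFun s := ⟨fun x => s.1 (x - c), by
    have := hF (-c) univ s.1 s.2.1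
    simpa only [sub_eq_add_neg, preimage_univ] using this,
    HasCompactSupport.of_compactSpace _⟩
  map_zero' := rfl
  map_add' _ _ := rfl

@[simp]
theorem shift_apply {F : IntSheaf Circ} (hF : RotationInvariant F) (c : Circ)
    (s : F.compactSections) (x : Circ) : (shift hF c s).1 x = s.1 (x - c) := rfl

/-- Translation on `Γ_c(S¹; 𝒮⁰)`. -/
abbrev shift0 : Circ → C00 →+ C00 := shift sheafS0_rotationInvariant

/-- Translation on `Γ_c(S¹; 𝒮¹)`. -/
abbrev shift1 : Circ → C01 →+ C01 := shift sheafS1_rotationInvariant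

theorem vert0_apply (a : C00) : (vert0 a).1 = jump id a.1 := rfl

theorem vert0_shift (p : Circ) (a : C00) : vert0 (shift0 p a) = shift1 p (vert0 a) :=
  Subtype.ext (funext fun x => jump_comp_sub a.2.1 p x)

/-- The indicator function of `[0, c)` as a section of `𝒮⁰`. -/
noncomputable def arcSection (c : ℝ) : C00 :=
  ⟨arc c, arc_mem c, HasCompactSupport.of_compactSpace _⟩

open Classical in
theorem shift1_point_apply (p x : Circ) :
    (shift1 p pointSection).1 x = if x = p then 1 else 0 := by
  simp only [shift_apply, pointSection, sub_eq_zero]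

theorem vert0_arcSection (c : ℝ) :
    vert0 (arcSection c) = pointSection - shift1 (c : Circ) pointSection := by
  classical
  refine Subtype.ext (funext fun x => (jump_arc c x).trans ?_)
  change _ = pointSection.1 x - (shift1 (c : Circ) pointSection).1 x
  rw [shift1_point_apply]
  simp only [pointSection]

theorem eq_const_of_vert0_eq_zero {a : C00} (h : vert0 a = 0) (x : Circ) : a.1 x = a.1 0 := by
  have hz : a.1 ∈ sheafZ.sec univ := mem_sheafZ_iff.2 ⟨a.2.1, fun x _ => by
    rw [← vert0_apply, h]; rfl⟩
  have : IsLocallyConstant a.1 := (IsLocallyConstant.iff_eventually_eq _).2 fun x => hz x (mem_univ x)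
  exact this.apply_eq_of_isPreconnected isPreconnected_univ (mem_univ _) (mem_univ _)

theorem oneSection_mem : oneSection ∈ CohZero := by
  refine (AddMonoidHom.mem_ker).2 (Subtype.ext ?_)
  rw [vert0_apply]
  funext x
  exact jump_id_eq (s := oneSection.1) (l := 1) (Eventually.of_forall fun _ => rfl)

theorem eq_zsmul_oneSection {a : C00} (h : vert0 a = 0) : a = a.1 0 • oneSection :=
  Subtype.ext (funext fun x => by
    rw [eq_const_of_vert0_eq_zero h x]
    simp [oneSection])

theorem finite_support_sheafS1 (b : C01) : (Function.support b.1).Finite := by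
  have := isCompact_univ (X := Circ) |>.induction_on
    (p := fun S => (S ∩ Function.support b.1).Finite) (by simp)
    (fun s t hst ht => ht.subset (inter_subset_inter_left _ hst))
    (fun s t hs ht => by rw [union_inter_distrib_right]; exact hs.union ht) ?_
  · simpa using this
  · intro x _
    refine ⟨{y | y ≠ x → b.1 y = 0}, mem_nhdsWithin_of_mem_nhds
      (eventually_nhdsWithin_iff.1 (b.2.1 x (mem_univ x))), (finite_singleton x).subset ?_⟩
    rintro y ⟨h1, h2⟩
    by_contra h
    exact h2 (h1 h)

theorem sheafS1_eq_sum (b : C01) :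
    b = ∑ p ∈ (finite_support_sheafS1 b).toFinset, b.1 p • shift1 p pointSection := by
  classical
  refine Subtype.ext (funext fun x => ?_)
  rw [AddSubgroup.val_finsetSum, Finset.sum_apply]
  have : ∀ p, (b.1 p • shift1 p pointSection).1 x = if p = x then b.1 p else 0 := fun p => by
    change b.1 p * (shift1 p pointSection).1 x = _
    rw [shift1_point_apply, mul_ite, mul_one, mul_zero]
    simp only [eq_comm]
  have h2 : ∀ p, (((b.1 p • shift1 p pointSection : C01)) : Circ → ℤ) x =
    if p = x then b.1 p else 0 := this
  simp only [h2]
  rw [Finset.sum_ite_eq']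
  split_ifs with h
  · rfl
  · simpa using h

/-- On the compact circle a section of $\mathcal S^1$ has finite support, so point masses generate
the group and additive statements need checking only on them. -/
theorem sheafS1_induction {P : C01 → Prop} (hpoint : ∀ p, P (shift1 p pointSection))
    (hzero : P 0) (hadd : ∀ b b', P b → P b' → P (b + b')) (hneg : ∀ b, P b → P (-b))
    (b : C01) : P b := by
  rw [sheafS1_eq_sum b]
  refine Finset.sum_induction _ P hadd hzero fun p _ => ?_
  induction b.1 p using Int.induction_on with
  | zero => simpa using hzero
  | succ n ih => rw [add_smul, one_smul]; exact hadd _ _ ih (hpoint p)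
  | pred n ih =>
    rw [sub_smul, one_smul, sub_eq_add_neg]
    exact hadd _ _ ih (hneg _ (hpoint p))

theorem exists_coe_eq (x : Circ) : ∃ u ∈ Ico (0 : ℝ) 1, (u : Circ) = x := by
  have h : x ∈ (univ : Set Circ) := mem_univ _
  rw [← AddCircle.coe_image_Ico_eq (1 : ℝ) 0, zero_add] at h
  exact h

theorem coe_inj_Ico {u v : ℝ} (hu : u ∈ Ico (0 : ℝ) 1) (hv : v ∈ Ico (0 : ℝ) 1) :
    (u : Circ) = v ↔ u = v := by
  refine AddCircle.coe_eq_coe_iff_of_mem_Ico (a := (0 : ℝ)) ?_ ?_ <;> simpa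

theorem exists_sub_zsmul_point_mem_range (b : C01) :
    ∃ n : ℤ, b - n • pointSection ∈ vert0.range := by
  induction b using sheafS1_induction with
  | hpoint p =>
    obtain ⟨u, hu, rfl⟩ := exists_coe_eq p
    refine ⟨1, -arcSection u, ?_⟩
    rw [map_neg, vert0_arcSection, one_smul, neg_sub]
  | hzero => exact ⟨0, by simp⟩
  | hadd b b' h h' =>
    obtain ⟨n, h⟩ := h
    obtain ⟨n', h'⟩ := h'
    refine ⟨n + n', ?_⟩
    have : b + b' - (n + n') • pointSection =
      (b - n • pointSection) + (b' - n' • pointSection) := by rw [add_smul]; abel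
    rw [this]
    exact add_mem h h'
  | hneg b h =>
    obtain ⟨n, h⟩ := h
    refine ⟨-n, ?_⟩
    have : -b - (-n) • pointSection = -(b - n • pointSection) := by rw [neg_smul]; abel
    rw [this]
    exact neg_mem h

/-! ### Integrals of sections of `𝒮⁰` -/

theorem finite_range_sheafS0 (a : C00) : (range a.1).Finite := by
  have := isCompact_univ (X := Circ) |>.induction_on
    (p := fun S => (a.1 '' S).Finite) (by simp)
    (fun s t hst ht => ht.subset (image_mono hst))
    (fun s t hs ht => by rw [image_union]; exact hs.union ht) ?_
  · simpa using this
  · intro x _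
    obtain ⟨⟨l, hl⟩, hr⟩ := mem_sheafS0_iff.1 a.2.1 x (mem_univ x)
    have h : ∀ᶠ y in 𝓝 x, a.1 y ∈ ({l, a.1 x} : Set ℤ) :=
      eventually_nhds_of_sides (hl.mono fun y hy => by simp [hy])
        (hr.mono fun y hy => by simp [hy]) (by simp)
    refine ⟨_, mem_nhdsWithin_of_mem_nhds h, (Set.toFinite {l, a.1 x}).subset ?_⟩
    rintro _ ⟨y, hy, rfl⟩
    exact hy

/-- The set `D` of discontinuities is finite by compactness, so every preimage is an open set
together with finitely many points. -/
theorem measurable_sheafS0 (a : C00) : Measurable a.1 := by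
  intro T _
  set D : Set Circ := {x | ¬ ∀ᶠ y in 𝓝 x, a.1 y = a.1 x}
  have hD : D.Finite := by
    have := isCompact_univ (X := Circ) |>.induction_on
      (p := fun S => (S ∩ D).Finite) (by simp)
      (fun s t hst ht => ht.subset (inter_subset_inter_left _ hst))
      (fun s t hs ht => by rw [union_inter_distrib_right]; exact hs.union ht) ?_
    · simpa using this
    · intro x _
      refine ⟨_, mem_nhdsWithin_of_mem_nhds
        (eventually_nhdsWithin_iff.1 (a.2.1.1 x (mem_univ x))), (finite_singleton x).subset ?_⟩
      rintro y ⟨h1, h2⟩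
      by_contra h
      exact h2 (tendsto_int_iff.1 (h1 h))
  have e : a.1 ⁻¹' T = interior (a.1 ⁻¹' T) ∪ (a.1 ⁻¹' T ∩ D) := by
    refine Subset.antisymm (fun x hx => ?_) (union_subset interior_subset inter_subset_left)
    by_cases h : x ∈ D
    · exact Or.inr ⟨hx, h⟩
    · left
      rw [mem_interior_iff_mem_nhds]
      have h' : ∀ᶠ y in 𝓝 x, a.1 y = a.1 x := not_not.1 h
      filter_upwards [h'] with y hy
      rw [mem_preimage, hy]
      exact hx
  rw [e]
  exact isOpen_interior.measurableSet.union (hD.subset inter_subset_right).measurableSet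

theorem integrable_sheafS0 (a : C00) : Integrable (fun x : Circ => ((a.1 x : ℤ) : ℂ)) volume := by
  obtain ⟨M, hM⟩ := ((finite_range_sheafS0 a).image fun n : ℤ => ‖(n : ℂ)‖).bddAbove
  refine Integrable.of_bound (C := M) ?_ (Eventually.of_forall fun x => hM ⟨_, ⟨x, rfl⟩, rfl⟩)
  exact ((measurable_from_top (f := fun n : ℤ => (n : ℂ))).comp
    (measurable_sheafS0 a)).aestronglyMeasurable

/-- The pairing of sections of `𝒮⁰` with Lebesgue measure. -/
noncomputable def integralHom : C00 →+ ℂ where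
  toFun a := ∫ x : Circ, ((a.1 x : ℤ) : ℂ)
  map_zero' := by simp
  map_add' a a' := by
    rw [← integral_add (integrable_sheafS0 a) (integrable_sheafS0 a')]
    simp

theorem integralHom_apply (a : C00) : integralHom a = ∫ x : Circ, ((a.1 x : ℤ) : ℂ) := rfl

theorem integralHom_shift (p : Circ) (a : C00) : integralHom (shift0 p a) = integralHom a :=
  integral_sub_right_eq_self (fun x : Circ => ((a.1 x : ℤ) : ℂ)) p

theorem integralHom_oneSection : integralHom oneSection = 1 := by
  simp [integralHom_apply, oneSection, measureReal_def]

theorem integralHom_arcSection {c : ℝ} (h0 : 0 ≤ c) (h1 : c < 1) :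
    integralHom (arcSection c) = c := by
  rw [integralHom_apply, ← UnitAddCircle.integral_preimage 0, zero_add,
    integral_Ioc_eq_integral_Ioo, ← integral_Ico_eq_integral_Ioo]
  have : ∀ u ∈ Ico (0 : ℝ) 1, (((arcSection c).1 (u : Circ) : ℤ) : ℂ) =
      indicator (Ico 0 c) (fun _ => (1 : ℂ)) u := by
    intro u hu
    change ((arc c (u : Circ) : ℤ) : ℂ) = _
    rw [arc_coe_of_mem h0 h1 hu, indicator_apply]
    simp [hu.1]
  rw [setIntegral_congr_fun measurableSet_Ico this, setIntegral_indicator measurableSet_Ico,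
    inter_eq_right.2 (Ico_subset_Ico_right h1.le)]
  simp [h0]

/-! ### Primitives -/

/-- Since $\theta<1$, the interval $[0,\theta)$ embeds in the circle and inherits finiteness from
the support of $b$. Additivity of the `finsum` over the arc needs this, because a `finsum` with
infinite support defaults to $0$. -/
theorem finite_arc_support {θ : ℝ} (h1 : θ < 1) (b : C01) :
    (Ico 0 θ ∩ Function.support fun t : ℝ => b.1 (-(t : Circ))).Finite := by
  refine Finite.of_finite_image (f := fun t : ℝ => -(t : Circ))
    ((finite_support_sheafS1 b).subset ?_) ?_
  · rintro _ ⟨t, ht, rfl⟩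
    exact ht.2
  · intro t ht t' ht' e
    exact (coe_inj_Ico ⟨ht.1.1, ht.1.2.trans h1⟩ ⟨ht'.1.1, ht'.1.2.trans h1⟩).1 (neg_inj.1 e)

theorem isPrimitive_iff {θ : ℝ} {b : C01} {a : C00} :
    IsPrimitive θ b a ↔ vert0 a = b - shift1 (θ : Circ) b ∧
      a.1 0 = ∑ᶠ (t : ℝ) (_ : t ∈ Ico 0 θ), b.1 (-(t : Circ)) :=
  and_congr ⟨fun h => Subtype.ext (funext h), fun h x => by rw [h]; rfl⟩ Iff.rfl

theorem IsPrimitive.add {θ : ℝ} (h1 : θ < 1) {b b' : C01} {a a' : C00} (h : IsPrimitive θ b a)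
    (h' : IsPrimitive θ b' a') : IsPrimitive θ (b + b') (a + a') := by
  rw [isPrimitive_iff] at *
  refine ⟨?_, ?_⟩
  · rw [map_add, h.1, h'.1, map_add]; abel
  · refine (congrArg₂ (· + ·) h.2 h'.2).trans ?_
    exact (finsum_mem_add_distrib' (finite_arc_support h1 b) (finite_arc_support h1 b')).symm

theorem IsPrimitive.neg {θ : ℝ} {b : C01} {a : C00} (h : IsPrimitive θ b a) :
    IsPrimitive θ (-b) (-a) := by
  rw [isPrimitive_iff] at *
  refine ⟨?_, ?_⟩
  · rw [map_neg, h.1, map_neg]; abel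
  · refine (congrArg Neg.neg h.2).trans ?_
    change _ = ∑ᶠ (t : ℝ) (_ : t ∈ Ico 0 θ), -b.1 (-(t : Circ))
    simp only [finsum_neg_distrib]

theorem IsPrimitive.zero (θ : ℝ) : IsPrimitive θ 0 0 := by
  rw [isPrimitive_iff]
  refine ⟨by simp, ?_⟩
  change (0 : ℤ) = ∑ᶠ (t : ℝ) (_ : t ∈ Ico 0 θ), 0
  simp

theorem IsPrimitive.unique {θ : ℝ} {b : C01} {a a' : C00} (h : IsPrimitive θ b a)
    (h' : IsPrimitive θ b a') : a = a' := by
  rw [isPrimitive_iff] at *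
  have hv : vert0 (a - a') = 0 := by rw [map_sub, h.1, h'.1, sub_self]
  have h0 : (a - a').1 0 = 0 := by
    change a.1 0 - a'.1 0 = 0
    rw [h.2, h'.2, sub_self]
  have := eq_zsmul_oneSection hv
  rw [h0, zero_smul] at this
  exact sub_eq_zero.1 this

/-- The arc $[p,p+\theta)$ jumps up at $p$ and down at $p+\theta$, and it contains $0$ exactly when
$p\in(-\theta,0]$. This is why the normalization sums $b$ over that arc. -/
theorem isPrimitive_point {θ : ℝ} (h0 : 0 ≤ θ) (h1 : θ < 1) (p : Circ) :
    IsPrimitive θ (shift1 p pointSection) (shift0 p (arcSection θ)) := by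
  classical
  rw [isPrimitive_iff]
  refine ⟨?_, ?_⟩
  · rw [vert0_shift, vert0_arcSection, map_sub]
    congr 1
    refine Subtype.ext (funext fun x => ?_)
    exact congrArg pointSection.1 (sub_right_comm _ _ _)
  · obtain ⟨u, hu, e⟩ := exists_coe_eq (-p)
    have e1 : (shift0 p (arcSection θ)).1 0 = arc θ (u : Circ) := by
      rw [shift_apply, zero_sub, e]; rfl
    have e2 : ∀ t : ℝ, t ∈ Ico 0 θ → (shift1 p pointSection).1 (-(t : Circ)) =
        if t = u then 1 else 0 := by
      intro t ht
      rw [shift1_point_apply]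
      have : -(t : Circ) = p ↔ t = u := by
        rw [← coe_inj_Ico ⟨ht.1, ht.2.trans h1⟩ hu, e]
        constructor
        · intro h; rw [← h, neg_neg]
        · intro h; rw [h, neg_neg]
      simp only [this]
    rw [e1, arc_coe_of_mem h0 h1 hu, finsum_mem_congr rfl e2]
    have e3 : ∀ t : ℝ, (∑ᶠ (_ : t ∈ Ico 0 θ), if t = u then (1 : ℤ) else 0) =
        if t = u then (if u < θ then 1 else 0) else 0 := by
      intro t
      rw [finsum_eq_if]
      by_cases h : t = u
      · subst h; simp [hu.1]
      · simp [h]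
    simp only [e3]
    rw [finsum_eq_single _ u (fun t ht => if_neg ht), if_pos rfl]

/-- That the integral lies in $\mathbb Z\theta$ is carried through the induction for use in
`isPrimitive_vert0`. -/
theorem exists_isPrimitive {θ : ℝ} (h0 : 0 ≤ θ) (h1 : θ < 1) (b : C01) :
    ∃ a : C00, IsPrimitive θ b a ∧ ∃ k : ℤ, integralHom a = k * θ := by
  induction b using sheafS1_induction with
  | hpoint p =>
    exact ⟨_, isPrimitive_point h0 h1 p, 1, by
      rw [integralHom_shift, integralHom_arcSection h0 h1]; simp⟩
  | hzero => exact ⟨0, IsPrimitive.zero θ, 0, by simp⟩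
  | hadd b b' h h' =>
    obtain ⟨a, h, k, hk⟩ := h
    obtain ⟨a', h', k', hk'⟩ := h'
    exact ⟨a + a', h.add h1 h', k + k', by rw [map_add, hk, hk']; push_cast; ring⟩
  | hneg b h =>
    obtain ⟨a, h, k, hk⟩ := h
    exact ⟨-a, h.neg, -k, by rw [map_neg, hk]; push_cast; ring⟩

theorem eq_zero_of_int_eq_int_mul {θ : ℝ} (hθ : Irrational θ) {n k : ℤ}
    (h : (n : ℂ) + k * θ = 0) : n = 0 ∧ k = 0 := by
  have h' : (n : ℝ) + k * θ = 0 := by exact_mod_cast h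
  have hk : k = 0 := by
    by_contra hk
    have := (hθ.intCast_mul hk).intCast_add n
    rw [h'] at this
    exact not_irrational_zero this
  subst hk
  simpa using h'

/-- A primitive attached to a coboundary `∂s` is `s - α(s)`. -/
theorem isPrimitive_vert0 {θ : ℝ} (hθ : Irrational θ) (h0 : 0 ≤ θ) (h1 : θ < 1) (s : C00) :
    IsPrimitive θ (vert0 s) (s - shift0 (θ : Circ) s) := by
  obtain ⟨a, ha, k, hk⟩ := exists_isPrimitive h0 h1 (vert0 s)
  have hv : vert0 (a - (s - shift0 (θ : Circ) s)) = 0 := by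
    rw [map_sub, (isPrimitive_iff.1 ha).1, map_sub, vert0_shift, sub_self]
  have e := eq_zsmul_oneSection hv
  set n := (a - (s - shift0 (θ : Circ) s)).1 0
  -- The two candidates have the same jumps, so they differ by an integer constant $n$. Integrating
  -- gives $k\theta=n$, because $s-\alpha(s)$ has integral $0$; irrationality forces $n=0$. No sum
  -- over the arc has to be computed.
  have e' := congrArg integralHom e
  rw [map_sub, map_sub, integralHom_shift, sub_self, sub_zero, hk, map_zsmul,
    integralHom_oneSection] at e'
  have : n = 0 := by
    have := (eq_zero_of_int_eq_int_mul hθ (n := -n) (k := k) (by rw [e']; simp)).1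
    omega
  rw [this, zero_smul, sub_eq_zero] at e
  rwa [← e]

/-! ### Sections supported on one sheet -/

theorem eventually_fst_eq (g : Arrow) : ∀ᶠ g' : Arrow in 𝓝 g, g'.1 = g.1 := by
  have : ∀ᶠ m in 𝓝 g.1, m = g.1 := by simp [nhds_discrete]
  exact (continuous_fst.tendsto g).eventually this

/-- The section of `F₁` given by `u` on the sheet `n` and by `0` elsewhere. -/
def slice (θ : ℝ) {F : IntSheaf Circ} (hF : RotationInvariant F) (n : ℤ) :
    F.compactSections →+ (F.pullback (rng θ)).compactSections where
  toFun u := ⟨fun g => if g.1 = n then u.1 g.2 else 0, by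
    constructor
    · intro g _
      by_cases h : g.1 = n
      · refine ⟨univ, isOpen_univ, mem_univ _, _, (shift hF (n • (θ : Circ)) u).2.1, ?_⟩
        filter_upwards [eventually_fst_eq g] with g' e
        simp [e, h, rng]
      · refine ⟨univ, isOpen_univ, mem_univ _, 0, (F.sec _).zero_mem, ?_⟩
        filter_upwards [eventually_fst_eq g] with g' e
        simp [e, h]
    · refine HasCompactSupport.intro (K := ({n} : Set ℤ) ×ˢ (univ : Set Circ))
        (isCompact_singleton.prod isCompact_univ) fun g hg => ?_
      have : g.1 ≠ n := fun h => hg ⟨h, mem_univ _⟩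
      simp [this]⟩
  map_zero' := Subtype.ext (funext fun g => by simp)
  map_add' u v := Subtype.ext (funext fun g => by
    change (if g.1 = n then u.1 g.2 + v.1 g.2 else 0) =
      (if g.1 = n then u.1 g.2 else 0) + (if g.1 = n then v.1 g.2 else 0)
    split_ifs <;> simp)

theorem slice_apply (θ : ℝ) {F : IntSheaf Circ} (hF : RotationInvariant F) (n : ℤ)
    (u : F.compactSections) (g : Arrow) :
    (slice θ hF n u).1 g = if g.1 = n then u.1 g.2 else 0 := rfl

/-- The restriction of a section of `F₁` to the sheet `n`. -/
def sheet (θ : ℝ) {F : IntSheaf Circ} (hF : RotationInvariant F) (n : ℤ)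
    (t : (F.pullback (rng θ)).compactSections) : F.compactSections :=
  ⟨fun x => t.1 (n, x), by
    refine ⟨F.glue fun x _ => ?_, HasCompactSupport.of_compactSpace _⟩
    obtain ⟨U, hU, hxU, s, hs, h⟩ := t.2.1 (n, x) (mem_univ _)
    have hc : Continuous fun y : Circ => ((n, y) : Arrow) := by fun_prop
    obtain ⟨W, hW, hWo, hxW⟩ := eventually_nhds_iff.1 (hc.continuousAt.eventually h)
    have hV : IsOpen ((fun y : Circ => y + n • (θ : Circ)) ⁻¹' U) :=
      hU.preimage (continuous_id.add continuous_const)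
    exact ⟨_, hV.inter hWo, ⟨hxU, hxW⟩, F.congr (hV.inter hWo)
      (fun y hy => (hW y hy.2).symm) (F.res inter_subset_left (hF (n • (θ : Circ)) U s hs))⟩⟩

theorem eq_sum_slice (θ : ℝ) {F : IntSheaf Circ} (hF : RotationInvariant F)
    (t : (F.pullback (rng θ)).compactSections) :
    ∃ A : Finset ℤ, t = ∑ n ∈ A, slice θ hF n (sheet θ hF n t) := by
  have hfin := (sheets_src θ).finite t.2.2
  refine ⟨hfin.toFinset, Subtype.ext (funext fun g => ?_)⟩
  rw [AddSubgroup.val_finsetSum, Finset.sum_apply]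
  simp only [slice_apply]
  rw [Finset.sum_ite_eq]
  split_ifs with h
  · rfl
  · by_contra hne
    refine h ?_
    rw [Finite.mem_toFinset]
    exact ⟨g, subset_tsupport _ hne, rfl⟩

/-- The section of `F₂` given by `u` on the component of the pairs `((m, x + nθ), (n, x))` and by
`0` elsewhere. -/
def pairSlice (θ : ℝ) {F : IntSheaf Circ} (hF : RotationInvariant F) (m n : ℤ)
    (u : F.compactSections) : (F.pullback (rng2 θ)).compactSections :=
  ⟨fun p => if p.1.1.1 = m ∧ p.1.2.1 = n then u.1 p.1.2.2 else 0, by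
    have hloc : ∀ p : Pairs θ, ∀ᶠ p' in 𝓝 p, p'.1.1.1 = p.1.1.1 ∧ p'.1.2.1 = p.1.2.1 := by
      intro p
      have c1 : Continuous fun p : Pairs θ => p.1.1 := by fun_prop
      have c2 : Continuous fun p : Pairs θ => p.1.2 := by fun_prop
      exact (c1.continuousAt.eventually (eventually_fst_eq p.1.1)).and
        (c2.continuousAt.eventually (eventually_fst_eq p.1.2))
    constructor
    · intro p _
      by_cases h : p.1.1.1 = m ∧ p.1.2.1 = n
      -- The pullback is along $x_0=x_2+n\theta+m\theta$, whereas $u$ is evaluated at $x_2$; the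
      -- shift compensates for this.
      · refine ⟨univ, isOpen_univ, mem_univ _, _,
          (shift hF (n • (θ : Circ) + m • (θ : Circ)) u).2.1, ?_⟩
        filter_upwards [hloc p] with p' e
        have hs := p'.2
        rw [if_pos (by rw [e.1, e.2]; exact h)]
        simp only [src] at hs
        simp only [rng2, rng, hs, shift_apply, e.1, e.2, h.1, h.2]
        abel_nf
      · refine ⟨univ, isOpen_univ, mem_univ _, 0, (F.sec _).zero_mem, ?_⟩
        filter_upwards [hloc p] with p' e
        rw [if_neg (by rw [e.1, e.2]; exact h)]
        rfl
    · have hc : Continuous fun x : Circ =>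
          (⟨((m, rng θ (n, x)), (n, x)), rfl⟩ : Pairs θ) := by
        have h : Continuous fun x : Circ => rng θ (n, x) := (continuous_rng θ).comp (by fun_prop)
        fun_prop
      refine HasCompactSupport.intro (isCompact_range hc) fun p hp => if_neg ?_
      rintro ⟨rfl, rfl⟩
      refine hp ⟨p.1.2.2, ?_⟩
      obtain ⟨⟨⟨m, x⟩, n, y⟩, h⟩ := p
      simp only [src] at h
      subst h
      rfl⟩

theorem pairSlice_apply (θ : ℝ) {F : IntSheaf Circ} (hF : RotationInvariant F) (m n : ℤ)
    (u : F.compactSections) (p : Pairs θ) :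
    (pairSlice θ hF m n u).1 p = if p.1.1.1 = m ∧ p.1.2.1 = n then u.1 p.1.2.2 else 0 := rfl

/-- A sum over a fibre is a sum over the sheets. -/
theorem Sheets.finsum_fibre {X Y D M : Type*} [TopologicalSpace X] [TopologicalSpace Y]
    [TopologicalSpace D] [AddCommMonoid M] {d : Y → X} {q : Y → D} {σ : D → X → Y} {τY : Y → Circ}
    {τX : X → Circ} {c : D → Circ} (S : Sheets d q σ τY τX c) (t : Y → M) (h : X) :
    ∑ᶠ (g : Y) (_ : d g = h), t g = ∑ᶠ k, t (σ k h) := by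
  rw [← finsum_mem_univ (fun k => t (σ k h))]
  symm
  refine finsum_mem_eq_of_bijOn (t := {g | d g = h}) (fun k => σ k h) ⟨?_, ?_, ?_⟩ fun _ _ => rfl
  · intro k _
    exact S.d_σ k h
  · intro k _ k' _ e
    have := congrArg q e
    simpa [S.q_σ] using this
  · intro g hg
    refine ⟨q g, mem_univ _, ?_⟩
    have e : d g = h := hg
    change σ (q g) h = g
    rw [← e, S.σ_qd]

theorem finsum_ite_eq_single {D : Type*} [DecidableEq D] (f : D → ℤ) (k : D) :
    ∑ᶠ j, (if j = k then f j else 0) = f k := by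
  rw [finsum_eq_single _ k fun j hj => if_neg hj, if_pos rfl]

theorem horiz1_apply (θ : ℝ) {F : IntSheaf Circ} (hF : RotationInvariant F)
    (t : (F.pullback (rng θ)).compactSections) (x : Circ) :
    (horiz1 θ hF t).1 x = ∑ᶠ k : ℤ, t.1 (k, x) - ∑ᶠ k : ℤ, t.1 (k, x - k • (θ : Circ)) := by
  rw [← (sheets_src θ).finsum_fibre, ← (sheets_rng θ).finsum_fibre]
  rfl

theorem horiz1_slice (θ : ℝ) {F : IntSheaf Circ} (hF : RotationInvariant F) (n : ℤ)
    (u : F.compactSections) :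
    horiz1 θ hF (slice θ hF n u) = u - shift hF (n • (θ : Circ)) u := by
  refine Subtype.ext (funext fun x => ?_)
  rw [horiz1_apply]
  simp only [slice_apply, finsum_ite_eq_single]
  rfl

theorem horiz2_apply (θ : ℝ) {F : IntSheaf Circ} (hF : RotationInvariant F)
    (t : (F.pullback (rng2 θ)).compactSections) (g : Arrow) :
    (horiz2 θ hF t).1 g = ∑ᶠ k : ℤ, t.1 ⟨((k, rng θ g), g), rfl⟩ -
      ∑ᶠ k : ℤ, t.1 ⟨((g.1 - k, rng θ (k, g.2)), (k, g.2)), rfl⟩ +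
      ∑ᶠ k : ℤ, t.1 ⟨(g, (k, g.2 - k • (θ : Circ))), by simp [src, rng]⟩ := by
  rw [← (sheets_face0 θ).finsum_fibre, ← (sheets_face1 θ).finsum_fibre,
    ← (sheets_face2 θ).finsum_fibre]
  rfl

/-- The faces of the pair $((m,x+n\theta),(n,x))$ are $(n,x)$, $(m+n,x)$ and $(m,x+n\theta)$. The
base point of the last is $x+n\theta$, hence the shift. -/
theorem horiz2_pairSlice (θ : ℝ) {F : IntSheaf Circ} (hF : RotationInvariant F) (m n : ℤ)
    (u : F.compactSections) :
    horiz2 θ hF (pairSlice θ hF m n u) =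
      slice θ hF n u - slice θ hF (m + n) u + slice θ hF m (shift hF (n • (θ : Circ)) u) := by
  refine Subtype.ext (funext fun g => ?_)
  rw [horiz2_apply]
  simp only [pairSlice_apply]
  change _ = (slice θ hF n u).1 g - (slice θ hF (m + n) u).1 g +
    (slice θ hF m (shift hF (n • (θ : Circ)) u)).1 g
  simp only [slice_apply, ite_and, finsum_ite_eq_single, shift_apply]
  congr 2
  · rw [finsum_eq_single _ n fun k hk => by simp [hk]]
    have : g.1 - n = m ↔ g.1 = m + n := sub_eq_iff_eq_add
    simp [this]
  · by_cases h : g.1 = m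
    · simp only [h, if_true, finsum_ite_eq_single]
    · simp [h]

/-- Modulo boundaries every section on `𝒢⁽¹⁾` is supported on the sheet `1`. -/
theorem exists_sub_slice_one_mem_range (θ : ℝ) {F : IntSheaf Circ} (hF : RotationInvariant F)
    (t : (F.pullback (rng θ)).compactSections) :
    ∃ v : F.compactSections, t - slice θ hF 1 v ∈ (horiz2 θ hF).range ⊓ (horiz1 θ hF).ker := by
  -- Intersecting with the kernel records $\delta\delta=0$ for the boundaries used here, so that
  -- subtracting them preserves cycles.
  set R := (horiz2 θ hF).range ⊓ (horiz1 θ hF).ker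
  have rel : ∀ (m n : ℤ) (u : F.compactSections), slice θ hF n u - slice θ hF (m + n) u +
      slice θ hF m (shift hF (n • (θ : Circ)) u) ∈ R := fun m n u =>
    ⟨⟨pairSlice θ hF m n u, horiz2_pairSlice θ hF m n u⟩, by
      have e : shift hF ((m + n) • (θ : Circ)) u =
          shift hF (m • (θ : Circ)) (shift hF (n • (θ : Circ)) u) :=
        Subtype.ext (funext fun x => by simp only [shift_apply, add_smul, sub_sub])
      change horiz1 θ hF _ = 0
      rw [map_add, map_sub, horiz1_slice, horiz1_slice, horiz1_slice, e]
      abel⟩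
  have key : ∀ (n : ℤ) (u : F.compactSections), ∃ v, slice θ hF n u - slice θ hF 1 v ∈ R := by
    intro n
    induction n using Int.induction_on with
    | zero =>
      intro u
      refine ⟨0, ?_⟩
      have h := rel 0 0 u
      have e : shift hF ((0 : ℤ) • (θ : Circ)) u = u :=
        Subtype.ext (funext fun x => by simp)
      rw [e, add_zero, sub_self, zero_add] at h
      simpa using h
    | succ n ih =>
      intro u
      obtain ⟨v, hv⟩ := ih (shift hF ((1 : ℤ) • (θ : Circ)) u)
      -- The component $(n,1)$ gives $u_{n+1}\equiv u_1+(\alpha u)_n$, with subscripts denoting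
      -- sheets, and induction replaces $(\alpha u)_n$ by $v_1$.
      refine ⟨u + v, ?_⟩
      have h := R.sub_mem hv (rel n 1 u)
      rw [map_add]
      convert h using 1
      abel
    | pred n ih =>
      intro u
      set w := shift hF (-((1 : ℤ) • (θ : Circ))) u with hw
      have e : shift hF ((1 : ℤ) • (θ : Circ)) w = u :=
        Subtype.ext (funext fun x => by simp [hw])
      obtain ⟨v, hv⟩ := ih w
      -- The same relation for the component $(-n-1,1)$, applied to $w=\alpha^{-1}u$, gives
      -- $u_{-n-1}\equiv w_{-n}-w_1$.
      refine ⟨v - w, ?_⟩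
      have h := R.add_mem hv (rel (-(n : ℤ) - 1) 1 w)
      rw [e, sub_add_cancel] at h
      rw [map_sub]
      convert h using 1
      abel
  obtain ⟨A, hA⟩ := eq_sum_slice θ hF t
  choose v hv using fun n => key n (sheet θ hF n t)
  refine ⟨∑ n ∈ A, v n, ?_⟩
  rw [map_sum]
  have : t - ∑ n ∈ A, slice θ hF 1 (v n) =
      ∑ n ∈ A, (slice θ hF n (sheet θ hF n t) - slice θ hF 1 (v n)) := by
    rw [Finset.sum_sub_distrib, ← hA]
  rw [this]
  exact R.sum_mem fun n _ => hv n

/-- Left limits on $\mathcal G$ are taken along the range map, while slices use the source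
coordinate. On one sheet the two differ by a rotation, which commutes with $\partial$. -/
theorem vert1_slice (θ : ℝ) (n : ℤ) (s : C00) :
    vert1 θ (slice θ sheafS0_rotationInvariant n s) =
      slice θ sheafS1_rotationInvariant n (vert0 s) := by
  refine Subtype.ext (funext fun g => ?_)
  change jump (rng θ) (slice θ sheafS0_rotationInvariant n s).1 g = _
  rw [slice_apply]
  split_ifs with h
  · have hloc : ∀ᶠ g' in 𝓝 g, (slice θ sheafS0_rotationInvariant n s).1 g' =
        (shift0 (n • (θ : Circ)) s).1 (rng θ g') := by
      filter_upwards [eventually_fst_eq g] with g' e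
      simp [slice_apply, e, h, rng]
    obtain ⟨l, hl⟩ := ((mem_sheafS0_iff.1 (shift0 (n • (θ : Circ)) s).2.1) (rng θ g)
      (mem_univ _)).1
    rw [(jump_eq (map_rng θ) hloc (tendsto_int_iff.2 hl)).2, ← jump_id_eq hl,
      ← vert0_apply, vert0_shift]
    simp [rng, h]
  · have hloc : ∀ᶠ g' in 𝓝 g, (slice θ sheafS0_rotationInvariant n s).1 g' =
        (fun _ : Circ => (0 : ℤ)) (rng θ g') := by
      filter_upwards [eventually_fst_eq g] with g' e
      simp [slice_apply, e, h]
    rw [(jump_eq (map_rng θ) hloc tendsto_const_nhds).2, sub_self]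

/-! ### The homology group in degree zero -/

theorem total0_apply (θ : ℝ) (a : C00) (b : C11 θ) :
    total0 θ (a, b) = vert0 a + horiz1 θ sheafS1_rotationInvariant b := rfl

theorem total1_apply (θ : ℝ) (e : C10 θ) (c : C21 θ) :
    total1 θ (e, c) = (horiz1 θ sheafS0_rotationInvariant e,
      -vert1 θ e + horiz2 θ sheafS1_rotationInvariant c) :=
  Prod.ext (add_zero _) rfl

theorem sliceOne_eq (θ : ℝ) (b : C01) : sliceOne θ b = slice θ sheafS1_rotationInvariant 1 b := rfl

theorem H0.cls_eq_iff {θ : ℝ} {z z' : Cycles θ} :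
    H0.cls z = H0.cls z' ↔ z.1 - z'.1 ∈ (total1 θ).range := by
  refine QuotientAddGroup.eq_iff_sub_mem.trans ?_
  rw [AddSubgroup.mem_addSubgroupOf]
  rfl

theorem mem_cycles_slice {θ : ℝ} {a : C00} {b : C01} (h : vert0 a = b - shift1 (θ : Circ) b) :
    (a, -sliceOne θ b) ∈ Cycles θ := by
  rw [AddMonoidHom.mem_ker, total0_apply, sliceOne_eq, map_neg, horiz1_slice, one_smul, h,
    add_neg_cancel]

theorem mem_cycles_of_vert0_eq_zero {θ : ℝ} {a : C00} (h : vert0 a = 0) :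
    (a, (0 : C11 θ)) ∈ Cycles θ := by
  rw [AddMonoidHom.mem_ker, total0_apply, h, map_zero, add_zero]

theorem integralHom_horiz1 (θ : ℝ) (e : C10 θ) :
    integralHom (horiz1 θ sheafS0_rotationInvariant e) = 0 := by
  obtain ⟨A, hA⟩ := eq_sum_slice θ sheafS0_rotationInvariant e
  rw [hA, map_sum, map_sum]
  refine Finset.sum_eq_zero fun n _ => ?_
  rw [horiz1_slice, map_sub]
  exact sub_eq_zero.2 (integralHom_shift _ _).symm

/-- The pairing of `H₀` with Lebesgue measure. -/
noncomputable def pairing (θ : ℝ) : H0 θ →+ ℂ :=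
  QuotientAddGroup.lift _
    (integralHom.comp ((AddMonoidHom.fst C00 (C11 θ)).comp (Cycles θ).subtype)) (by
      rintro z ⟨⟨e, c⟩, h⟩
      rw [total1_apply] at h
      have h1 : horiz1 θ sheafS0_rotationInvariant e = z.1.1 := congrArg Prod.fst h
      rw [AddMonoidHom.mem_ker]
      change integralHom z.1.1 = 0
      rw [← h1, integralHom_horiz1])

theorem pairing_cls {θ : ℝ} (z : Cycles θ) : pairing θ (H0.cls z) = integralHom z.1.1 := rfl

/-- The map `φ₀`. -/
noncomputable def phi0 (θ : ℝ) : CohZero →+ H0 θ :=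
  (QuotientAddGroup.mk' _).comp
    { toFun := fun a => ⟨(a.1, 0), mem_cycles_of_vert0_eq_zero a.2⟩
      map_zero' := rfl
      map_add' := fun _ _ => Subtype.ext (Prod.ext rfl (add_zero _).symm) }

theorem phi0_apply {θ : ℝ} (a : CohZero) :
    phi0 θ a = H0.cls ⟨(a.1, 0), mem_cycles_of_vert0_eq_zero a.2⟩ := rfl

/-- The section `a_b`. -/
noncomputable def primitive {θ : ℝ} (h0 : 0 ≤ θ) (h1 : θ < 1) (b : C01) : C00 := (exists_isPrimitive h0 h1 b).choose

theorem isPrimitive_primitive {θ : ℝ} (h0 : 0 ≤ θ) (h1 : θ < 1) (b : C01) : IsPrimitive θ b (primitive h0 h1 b) :=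
  (exists_isPrimitive h0 h1 b).choose_spec.1

/-- The map `φ₁` on sections. -/
noncomputable def phi1Aux {θ : ℝ} (h0 : 0 ≤ θ) (h1 : θ < 1) : C01 →+ H0 θ :=
  (QuotientAddGroup.mk' _).comp <| AddMonoidHom.mk' (fun b => (⟨(primitive h0 h1 b, -sliceOne θ b),
      mem_cycles_slice (isPrimitive_iff.1 (isPrimitive_primitive h0 h1 b)).1⟩ : Cycles θ))
    fun b b' => Subtype.ext (Prod.ext
      ((isPrimitive_primitive h0 h1 _).unique ((isPrimitive_primitive h0 h1 b).add h1
        (isPrimitive_primitive h0 h1 b')))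
      (by simp only [sliceOne_eq, map_add, neg_add]; rfl))

theorem phi1Aux_apply {θ : ℝ} (h0 : 0 ≤ θ) (h1 : θ < 1) {b : C01} {a : C00} (h : IsPrimitive θ b a) :
    phi1Aux h0 h1 b = H0.cls ⟨(a, -sliceOne θ b), mem_cycles_slice (isPrimitive_iff.1 h).1⟩ := by
  obtain rfl := h.unique (isPrimitive_primitive h0 h1 b)
  rfl

/-- With the primitive $s-\alpha(s)$, the cycle is the total boundary of $s$ placed on the sheet
$1$. -/
theorem phi1Aux_vert0 {θ : ℝ} (hθ : Irrational θ) (h0 : 0 ≤ θ) (h1 : θ < 1) (s : C00) :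
    phi1Aux h0 h1 (vert0 s) = 0 := by
  rw [phi1Aux_apply h0 h1 (isPrimitive_vert0 hθ h0 h1 s)]
  refine (H0.cls_eq_iff (z' := 0)).2 ⟨(slice θ sheafS0_rotationInvariant 1 s, 0), ?_⟩
  rw [total1_apply, horiz1_slice, vert1_slice, map_zero, one_smul, add_zero]
  exact (sub_zero _).symm

/-- The map `φ₁`. -/
noncomputable def phi1 {θ : ℝ} (hθ : Irrational θ) (h0 : 0 ≤ θ) (h1 : θ < 1) : CohOne →+ H0 θ :=
  QuotientAddGroup.lift _ (phi1Aux h0 h1) (by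
    rintro _ ⟨s, rfl⟩
    exact phi1Aux_vert0 hθ h0 h1 s)

theorem phi1_apply {θ : ℝ} (hθ : Irrational θ) (h0 : 0 ≤ θ) (h1 : θ < 1) {b : C01}
    {a : C00} (h : IsPrimitive θ b a) : phi1 hθ h0 h1 (CohOne.cls b) =
    H0.cls ⟨(a, -sliceOne θ b), mem_cycles_slice (isPrimitive_iff.1 h).1⟩ :=
  phi1Aux_apply h0 h1 h

/-! ### Generators, and the isomorphism -/

theorem pairing_phi0_one {θ : ℝ} :
    pairing θ (phi0 θ ⟨oneSection, oneSection_mem⟩) = 1 := by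
  rw [phi0_apply, pairing_cls, integralHom_oneSection]

theorem pairing_phi1_point {θ : ℝ} (hθ : Irrational θ) (h0 : 0 ≤ θ) (h1 : θ < 1) :
    pairing θ (phi1 hθ h0 h1 (CohOne.cls pointSection)) = θ := by
  have e : shift1 0 pointSection = pointSection :=
    Subtype.ext (funext fun x => by simp only [shift_apply, sub_zero])
  have h := isPrimitive_point h0 h1 0
  rw [e] at h
  rw [phi1_apply hθ h0 h1 h, pairing_cls, integralHom_shift, integralHom_arcSection h0 h1]

theorem cohZero_eq (a : CohZero) :
    a = a.1.1 0 • (⟨oneSection, oneSection_mem⟩ : CohZero) :=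
  Subtype.ext (eq_zsmul_oneSection a.2)

theorem cohOne_eq (b : CohOne) : ∃ n : ℤ, b = n • CohOne.cls pointSection := by
  obtain ⟨b, rfl⟩ := QuotientAddGroup.mk_surjective b
  obtain ⟨n, hn⟩ := exists_sub_zsmul_point_mem_range b
  exact ⟨n, QuotientAddGroup.eq_iff_sub_mem.2 hn⟩

theorem pairing_coprod {θ : ℝ} (hθ : Irrational θ) (h0 : 0 ≤ θ) (h1 : θ < 1) (n k : ℤ) :
    pairing θ ((phi0 θ).coprod (phi1 hθ h0 h1)
      (n • (⟨oneSection, oneSection_mem⟩ : CohZero), k • CohOne.cls pointSection)) =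
      n + k * θ := by
  rw [AddMonoidHom.coprod_apply, map_add, map_zsmul, map_zsmul, map_zsmul, map_zsmul,
    pairing_phi0_one, pairing_phi1_point]
  simp

theorem coprod_injective {θ : ℝ} (hθ : Irrational θ) (h0 : 0 ≤ θ) (h1 : θ < 1) :
    Function.Injective ((phi0 θ).coprod (phi1 hθ h0 h1)) := by
  rw [injective_iff_map_eq_zero]
  rintro ⟨a, b⟩ h
  obtain ⟨k, rfl⟩ := cohOne_eq b
  rw [cohZero_eq a] at h ⊢
  have e := pairing_coprod hθ h0 h1 (a.1.1 0) k
  rw [h, map_zero] at e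
  obtain ⟨hn, hk⟩ := eq_zero_of_int_eq_int_mul hθ e.symm
  rw [hn, hk, zero_smul, zero_smul]
  rfl

theorem coprod_surjective {θ : ℝ} (hθ : Irrational θ) (h0 : 0 ≤ θ) (h1 : θ < 1) :
    Function.Surjective ((phi0 θ).coprod (phi1 hθ h0 h1)) := by
  intro y
  obtain ⟨⟨⟨a, b⟩, hz⟩, rfl⟩ := QuotientAddGroup.mk_surjective y
  obtain ⟨v, ⟨c, hc⟩, hv⟩ := exists_sub_slice_one_mem_range θ sheafS1_rotationInvariant b
  have hd : total0 θ (a, slice θ sheafS1_rotationInvariant 1 v) = 0 := by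
    have hbd : total0 θ (0, b - slice θ sheafS1_rotationInvariant 1 v) = 0 := by
      rw [total0_apply, map_zero, zero_add]
      exact hv
    have e : ((a, slice θ sheafS1_rotationInvariant 1 v) : C00 × C11 θ) =
        (a, b) - (0, b - slice θ sheafS1_rotationInvariant 1 v) := by simp
    rw [e, map_sub, hbd, sub_zero]
    exact hz
  rw [total0_apply, horiz1_slice, one_smul] at hd
  -- The sign is that of $-b_1$ in $\phi_1$: the class of $-v$ has second component $v$ on the sheet
  -- $1$.
  obtain ⟨a', ha', -⟩ := exists_isPrimitive h0 h1 (-v)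
  have hker : vert0 (a - a') = 0 := by
    rw [map_sub, (isPrimitive_iff.1 ha').1, eq_neg_of_add_eq_zero_left hd, map_neg]
    abel
  refine ⟨(⟨a - a', hker⟩, CohOne.cls (-v)), ?_⟩
  rw [AddMonoidHom.coprod_apply, phi1_apply hθ h0 h1 ha', phi0_apply]
  refine H0.cls_eq_iff.2 ⟨(0, -c), ?_⟩
  rw [total1_apply, map_zero, map_zero, map_neg, hc]
  refine Prod.ext ?_ ?_
  · change 0 = (a - a') + a' - a
    abel
  · change -0 + -(b - slice θ sheafS1_rotationInvariant 1 v) =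
      0 + -slice θ sheafS1_rotationInvariant 1 (-v) - b
    rw [map_neg]
    abel

/-! ### Invariant measures -/

theorem isInvariant_volume (θ : ℝ) : IsInvariant θ volume := by
  classical
  intro f hf hcs
  set A : Finset ℤ := ((IsCompact.image hcs continuous_fst).finite_of_discrete).toFinset with hA
  have hout : ∀ (k : ℤ), k ∉ A → ∀ x, f (k, x) = 0 := by
    intro k hk x
    by_contra hne
    refine hk ?_
    rw [hA, Finite.mem_toFinset]
    exact ⟨(k, x), subset_tsupport _ hne, rfl⟩
  have hsum : ∀ y : ℤ → Circ, ∑ᶠ k : ℤ, f (k, y k) = ∑ k ∈ A, f (k, y k) := fun y =>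
    finsum_eq_sum_of_support_subset _ fun k hk => by
      by_contra h
      exact hk (hout k h _)
  have hint : ∀ k : ℤ, Integrable (fun x : Circ => f (k, x)) volume := fun k =>
    (show Continuous fun x : Circ => f (k, x) by fun_prop).integrable_of_hasCompactSupport
      (HasCompactSupport.of_compactSpace _)
  simp only [(sheets_rng θ).finsum_fibre, (sheets_src θ).finsum_fibre]
  have e1 : ∀ x : Circ, ∑ᶠ k : ℤ, f (k, x - k • (θ : Circ)) =
    ∑ k ∈ A, f (k, x - k • (θ : Circ)) := fun x => hsum fun k => x - k • (θ : Circ)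
  have e2 : ∀ x : Circ, ∑ᶠ k : ℤ, f (k, x) = ∑ k ∈ A, f (k, x) := fun x => hsum fun _ => x
  simp only [e1, e2]
  rw [integral_finsetSum _ fun k _ => (hint k).comp_sub_right _,
    integral_finsetSum _ fun k _ => hint k]
  exact Finset.sum_congr rfl fun k _ =>
    integral_sub_right_eq_self (fun x : Circ => f (k, x)) (k • (θ : Circ))

/-- Sheets are open and closed, so $g$ on the sheet $n$ extended by zero is an admissible test
function. -/
theorem IsInvariant.integral_sub {θ : ℝ} {μ : Measure Circ} (h : IsInvariant θ μ)
    (g : C(Circ, ℝ)) (n : ℤ) : ∫ x, g (x - n • (θ : Circ)) ∂μ = ∫ x, g x ∂μ := by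
  classical
  have hc : Continuous fun p : Arrow => if p.1 = n then g p.2 else 0 := by
    refine continuous_iff_continuousAt.2 fun p => ?_
    have : (fun p : Arrow => if p.1 = n then g p.2 else 0) =ᶠ[𝓝 p]
        fun p' => if p.1 = n then g p'.2 else 0 := by
      filter_upwards [eventually_fst_eq p] with p' e
      rw [e]
    refine ContinuousAt.congr ?_ this.symm
    by_cases hp : p.1 = n
    · simp only [hp, if_true]; fun_prop
    · simp only [hp, if_false]; fun_prop
  have hs : HasCompactSupport fun p : Arrow => if p.1 = n then g p.2 else 0 := by
    refine HasCompactSupport.intro (K := ({n} : Set ℤ) ×ˢ (univ : Set Circ))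
      (isCompact_singleton.prod isCompact_univ) fun p hp => if_neg fun e => hp ⟨e, mem_univ _⟩
  have := h _ hc hs
  simp only [(sheets_rng θ).finsum_fibre, (sheets_src θ).finsum_fibre] at this
  have key : ∀ y : ℤ → Circ, ∑ᶠ k : ℤ, (if k = n then g (y k) else 0) = g (y n) := fun y => by
    rw [finsum_eq_single _ n fun k hk => if_neg hk, if_pos rfl]
  have e1 : ∀ x : Circ, ∑ᶠ k : ℤ, (if k = n then g (x - k • (θ : Circ)) else 0) =
    g (x - n • (θ : Circ)) := fun x => key fun k => x - k • (θ : Circ)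
  have e2 : ∀ x : Circ, ∑ᶠ k : ℤ, (if k = n then g x else 0) = g x := fun x => key fun _ => x
  simpa only [e1, e2] using this

theorem IsInvariant.eq_volume {θ : ℝ} (hθ : Irrational θ) {μ : Measure Circ}
    [IsProbabilityMeasure μ] (h : IsInvariant θ μ) : μ = volume := by
  have hdense : DenseRange fun n : ℤ => n • (θ : Circ) :=
    AddCircle.denseRange_zsmul_coe_iff.2 (by simpa using hθ)
  have key : ∀ (g : C(Circ, ℝ)) (c : Circ), ∫ x, g (x - c) ∂μ = ∫ x, g x ∂μ := by
    intro g
    have hcont : Continuous fun c : Circ => ∫ x, g (x - c) ∂μ := by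
      refine continuous_of_dominated (bound := fun _ => ‖g‖) (fun c => ?_) (fun c => ?_)
        (integrable_const _) (Eventually.of_forall fun x => by fun_prop)
      · exact (show Continuous fun x => g (x - c) by fun_prop).aestronglyMeasurable
      · exact Eventually.of_forall fun x => g.norm_coe_le_norm _
    -- The integral of a translate depends continuously on the translation and is constant on the
    -- dense orbit of $\theta$, so it is constant.
    have := hdense.equalizer hcont continuous_const (funext fun n => h.integral_sub g n)
    exact fun c => congrFun this c
  have hinv : μ.IsAddLeftInvariant := by
    refine ⟨fun c => ?_⟩
    have : IsFiniteMeasure (μ.map (c + ·)) := Measure.isFiniteMeasure_map μ _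
    refine ext_of_forall_integral_eq_of_IsFiniteMeasure fun f => ?_
    rw [integral_map (by fun_prop) f.continuous.aestronglyMeasurable]
    have := key f.toContinuousMap (-c)
    simp only [sub_neg_eq_add] at this
    simp only [add_comm c]
    exact this
  have : IsProbabilityMeasure (volume : Measure Circ) := ⟨UnitAddCircle.measure_univ⟩
  have hHaar : μ.IsAddHaarMeasure :=
    Measure.isAddHaarMeasure_of_isCompact_nonempty_interior μ univ isCompact_univ
      (by simp) (by simp) (by simp)
  exact Measure.isAddHaarMeasure_eq_of_isProbabilityMeasure μ volume

theorem isInvariant_iff {θ : ℝ} (hθ : Irrational θ) (μ : Measure Circ) :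
    (IsProbabilityMeasure μ ∧ IsInvariant θ μ) ↔ μ = volume := by
  constructor
  · rintro ⟨_, h⟩
    exact h.eq_volume hθ
  · rintro rfl
    exact ⟨⟨UnitAddCircle.measure_univ⟩, isInvariant_volume θ⟩

/-! ### Uniqueness of the coefficients, and `H₀ ≅ ℤ ⊕ ℤ` -/

theorem existsUnique_zsmul_oneSection (a : CohZero) :
    ∃! n : ℤ, a = n • (⟨oneSection, oneSection_mem⟩ : CohZero) := by
  refine ⟨_, cohZero_eq a, fun n hn => ?_⟩
  subst hn
  change n = n * 1
  rw [mul_one]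

/-- Uniqueness uses no degree map on $H^1(S^1)$: the image under $\phi_1$ of $n$ times the generator
pairs to $n\theta$, which determines $n$. -/
theorem existsUnique_zsmul_pointSection {θ : ℝ} (hθ : Irrational θ) (h0 : 0 ≤ θ) (h1 : θ < 1)
    (b : CohOne) : ∃! n : ℤ, b = n • CohOne.cls pointSection := by
  obtain ⟨n, rfl⟩ := cohOne_eq b
  refine ⟨n, rfl, fun m hm => ?_⟩
  have e := pairing_coprod hθ h0 h1 0 n
  rw [hm, pairing_coprod hθ h0 h1 0 m] at e
  have := (eq_zero_of_int_eq_int_mul hθ (n := 0) (k := m - n) (by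
    push_cast at e ⊢; linear_combination e)).2
  omega

theorem nonempty_H0_equiv {θ : ℝ} (hθ : Irrational θ) (h0 : 0 ≤ θ) (h1 : θ < 1) :
    Nonempty (H0 θ ≃+ ℤ × ℤ) := by
  let f₀ := zmultiplesHom CohZero ⟨oneSection, oneSection_mem⟩
  let f₁ := zmultiplesHom CohOne (CohOne.cls pointSection)
  have h₀ : Function.Bijective f₀ :=
    ⟨fun n m e => (existsUnique_zsmul_oneSection (f₀ n)).unique rfl e,
      fun a => ⟨_, (cohZero_eq a).symm⟩⟩
  have h₁ : Function.Bijective f₁ :=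
    ⟨fun n m e => (existsUnique_zsmul_pointSection hθ h0 h1 (f₁ n)).unique rfl e,
      fun b => (cohOne_eq b).imp fun _ h => h.symm⟩
  exact ⟨((AddEquiv.ofBijective f₀ h₀).prodCongr (AddEquiv.ofBijective f₁ h₁) |>.trans
    (AddEquiv.ofBijective _ ⟨coprod_injective hθ h0 h1, coprod_surjective hθ h0 h1⟩)).symm⟩

end RotationGroupoid

theorem mainTheorem3 (θ : ℝ) (hθ : Irrational θ) (h0 : 0 ≤ θ) (h1 : θ < 1) :
    IsSoftResolution ∧
    (∀ μ : Measure Circ, (IsProbabilityMeasure μ ∧ IsInvariant θ μ) ↔ μ = volume) ∧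
    ∃ (hone : oneSection ∈ CohZero) (φ₀ : CohZero →+ H0 θ) (φ₁ : CohOne →+ H0 θ)
      (τ : H0 θ →+ ℂ),
      -- the map `φ₀`
      (∀ a : CohZero, ∃ z : Cycles θ, z.1 = (a.1, 0) ∧ φ₀ a = H0.cls z) ∧
      -- the map `φ₁`
      (∀ b : C01, ∃! a : C00, IsPrimitive θ b a) ∧
      (∀ (b : C01) (a : C00), IsPrimitive θ b a →
        ∃ z : Cycles θ, z.1 = (a, -sliceOne θ b) ∧ φ₁ (CohOne.cls b) = H0.cls z) ∧
      -- the pairing with Lebesgue measure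
      (∀ z : Cycles θ, Integrable (fun x : Circ => ((z.1.1.1 x : ℤ) : ℂ)) volume ∧
        τ (H0.cls z) = ∫ x : Circ, ((z.1.1.1 x : ℤ) : ℂ)) ∧
      -- the isomorphism
      Function.Bijective (φ₀.coprod φ₁) ∧
      Nonempty (H0 θ ≃+ ℤ × ℤ) ∧
      -- the generators and their pairings
      (∀ a : CohZero, ∃! n : ℤ, a = n • (⟨oneSection, hone⟩ : CohZero)) ∧
      (∀ b : CohOne, ∃! n : ℤ, b = n • CohOne.cls pointSection) ∧
      τ (φ₀ ⟨oneSection, hone⟩) = 1 ∧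
      τ (φ₁ (CohOne.cls pointSection)) = (θ : ℂ) := by
  refine ⟨isSoftResolution, isInvariant_iff hθ, oneSection_mem, phi0 θ, phi1 hθ h0 h1, pairing θ,
    fun a => ⟨_, rfl, phi0_apply a⟩, fun b => ?_, fun b a h => ⟨_, rfl, phi1_apply hθ h0 h1 h⟩,
    fun z => ⟨integrable_sheafS0 z.1.1, rfl⟩,
    ⟨coprod_injective hθ h0 h1, coprod_surjective hθ h0 h1⟩, nonempty_H0_equiv hθ h0 h1,
    existsUnique_zsmul_oneSection, existsUnique_zsmul_pointSection hθ h0 h1,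
    pairing_phi0_one, pairing_phi1_point hθ h0 h1⟩
  obtain ⟨a, ha, -⟩ := exists_isPrimitive h0 h1 b
  exact ⟨a, ha, fun a' ha' => ha'.unique ha⟩
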